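/- Let $(M,g)$ be an oriented smooth Riemannian $4$-manifold, with Levi-Civita connection $D$, such that $g$ is Einstein ($\mathrm{Ric}=c\,g$ with $c$ constant), its scalar curvature is nowhere zero, and its Weyl curvature is selfdual ($*W=W$). Let $K$ and $\tilde K$ be smooth Killing fields of $g$ with $[K,\tilde K]=0$. View $DK$ and $D\tilde K$ as the $2$-forms $(X,Y)\mapsto g(D_XK,Y)$ and $(X,Y)\mapsto g(D_X\tilde K,Y)$, and let $*$ be the Hodge star. Then: (i) both twist scalars $(*DK)(K,\tilde K)$ and $(*D\tilde K)(K,\tilde K)$ vanish identically on $M$; (ii) on the open set $U\subseteq M$ of points $x$ at which $K_x,\tilde K_x$ are linearly independent, the rank two distribution $\langle K,\tilde K\rangle^{\perp}$ is integrable: through every point of $U$ there passes a smoothly immersed surface in $U$ whose tangent plane at each of its points is $\langle K,\tilde K\rangle^{\perp}$. In particular, if $K$ and $\tilde K$ are linearly independent at every point, then the orthogonal distribution to $\langle K,\tilde K\rangle$ is integrable on all of $M$. -/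

import Mathlib

open Bundle VectorField Module
open scoped Manifold ContDiff Topology

noncomputable section

namespace SelfdualEinstein

section LeviCivita

variable {E : Type*} [NormedAddCommGroup E] [NormedSpace ℝ E]
  {H : Type*} [TopologicalSpace H] (I : ModelWithCorners ℝ E H)
  {M : Type*} [TopologicalSpace M] [ChartedSpace H M]
  [RiemannianBundle (fun x : M => TangentSpace I x)]

/-! ### The Levi-Civita connection, constructed from the Koszul formula -/

/-- The Koszul expression `½ (X⟨Y,Z⟩ + Y⟨X,Z⟩ - Z⟨X,Y⟩ + ⟨[X,Y],Z⟩ - ⟨[X,Z],Y⟩ - ⟨[Y,Z],X⟩)`,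
which is the value of `⟨∇_X Y, Z⟩` for the Levi-Civita connection `∇`. -/
def koszul (X Y Z : Π x : M, TangentSpace I x) (x : M) : ℝ :=
  (1 / 2 : ℝ) *
    (d% (fun y => inner ℝ (Y y) (Z y)) x (X x) + d% (fun y => inner ℝ (X y) (Z y)) x (Y x)
      - d% (fun y => inner ℝ (X y) (Y y)) x (Z x)
      + inner ℝ (mlieBracket I X Y x) (Z x) - inner ℝ (mlieBracket I X Z x) (Y x)
      - inner ℝ (mlieBracket I Y Z x) (X x))

theorem koszul_add_swap (X Y Z : Π x : M, TangentSpace I x) (x : M) :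
    koszul I X Y Z x + koszul I X Z Y x = d% (fun y => inner ℝ (Y y) (Z y)) x (X x) := by
  have h : mlieBracket I Z Y x = - mlieBracket I Y Z x := mlieBracket_swap_apply
  simp only [koszul, h, inner_neg_left, real_inner_comm (Z _) (Y _)]
  ring

theorem koszul_sub_swap (X Y Z : Π x : M, TangentSpace I x) (x : M) :
    koszul I X Y Z x - koszul I Y X Z x = inner ℝ (mlieBracket I X Y x) (Z x) := by
  have h : mlieBracket I Y X x = - mlieBracket I X Y x := mlieBracket_swap_apply
  simp only [koszul, h, inner_neg_left, real_inner_comm (Y _) (X _)]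
  ring

variable [IsManifold I ∞ M] [IsContMDiffRiemannianBundle I ∞ E (fun x : M => TangentSpace I x)]

theorem mdifferentiableAt_inner {X Y : Π x : M, TangentSpace I x} {x : M}
    (hX : MDiffAt (T% X) x) (hY : MDiffAt (T% Y) x) :
    MDiffAt (fun y => inner ℝ (X y) (Y y)) x :=
  MDifferentiableAt.inner_bundle (E := fun x : M => TangentSpace I x) (b := fun y => y) hX hY

variable [FiniteDimensional ℝ E]

theorem koszul_tensorial_left {Y Z : Π x : M, TangentSpace I x} {x : M}
    (hY : MDiffAt (T% Y) x) (hZ : MDiffAt (T% Z) x) :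
    TensorialAt I E (fun X => koszul I X Y Z x) x where
  smul {f X} hf hX := by
    have := FiniteDimensional.complete ℝ E
    have h1 := mvfderiv_fun_mul hf (mdifferentiableAt_inner I hX hZ)
    have h2 := mvfderiv_fun_mul hf (mdifferentiableAt_inner I hX hY)
    simp only [koszul, Pi.smul_apply', real_inner_smul_left, real_inner_smul_right, inner_add_left,
      mlieBracket_smul_left hf hX, h1, h2, add_apply, smul_apply, smul_eq_mul, map_smul]
    simp only [real_inner_comm (X _)]
    ring
  add {X X'} hX hX' := by
    have := FiniteDimensional.complete ℝ E
    have h1 := mvfderiv_fun_add (mdifferentiableAt_inner I hX hZ) (mdifferentiableAt_inner I hX' hZ)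
    have h2 := mvfderiv_fun_add (mdifferentiableAt_inner I hX hY) (mdifferentiableAt_inner I hX' hY)
    simp only [koszul, Pi.add_apply, inner_add_left, inner_add_right, h1, h2,
      mlieBracket_add_left hX hX', add_apply, map_add]
    ring

theorem koszul_tensorial_right {X Y : Π x : M, TangentSpace I x} {x : M}
    (hX : MDiffAt (T% X) x) (hY : MDiffAt (T% Y) x) :
    TensorialAt I E (fun Z => koszul I X Y Z x) x where
  smul {f Z} hf hZ := by
    have := FiniteDimensional.complete ℝ E
    have h1 := mvfderiv_fun_mul hf (mdifferentiableAt_inner I hY hZ)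
    have h2 := mvfderiv_fun_mul hf (mdifferentiableAt_inner I hX hZ)
    simp only [koszul, Pi.smul_apply', real_inner_smul_left, real_inner_smul_right, inner_add_left,
      mlieBracket_smul_right hf hZ, h1, h2, add_apply, smul_apply, smul_eq_mul, map_smul]
    simp only [real_inner_comm (Z _), real_inner_comm (Y _) (X _)]
    ring
  add {Z Z'} hZ hZ' := by
    have := FiniteDimensional.complete ℝ E
    have h1 := mvfderiv_fun_add (mdifferentiableAt_inner I hY hZ) (mdifferentiableAt_inner I hY hZ')
    have h2 := mvfderiv_fun_add (mdifferentiableAt_inner I hX hZ) (mdifferentiableAt_inner I hX hZ')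
    simp only [koszul, Pi.add_apply, inner_add_left, inner_add_right, h1, h2,
      mlieBracket_add_right hZ hZ', add_apply, map_add]
    ring

theorem koszul_add_middle {X Y Y' Z : Π x : M, TangentSpace I x} {x : M}
    (hX : MDiffAt (T% X) x) (hY : MDiffAt (T% Y) x) (hY' : MDiffAt (T% Y') x)
    (hZ : MDiffAt (T% Z) x) :
    koszul I X (Y + Y') Z x = koszul I X Y Z x + koszul I X Y' Z x := by
  have := FiniteDimensional.complete ℝ E
  have h1 := mvfderiv_fun_add (mdifferentiableAt_inner I hY hZ) (mdifferentiableAt_inner I hY' hZ)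
  have h2 := mvfderiv_fun_add (mdifferentiableAt_inner I hX hY) (mdifferentiableAt_inner I hX hY')
  simp only [koszul, Pi.add_apply, inner_add_left, inner_add_right, h1, h2,
    mlieBracket_add_left hY hY', mlieBracket_add_right hY hY', add_apply, map_add]
  ring

theorem koszul_smul_middle {X Y Z : Π x : M, TangentSpace I x} {f : M → ℝ} {x : M}
    (hX : MDiffAt (T% X) x) (hf : MDiffAt f x) (hY : MDiffAt (T% Y) x) (hZ : MDiffAt (T% Z) x) :
    koszul I X (f • Y) Z x = f x * koszul I X Y Z x + d% f x (X x) * inner ℝ (Y x) (Z x) := by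
  have := FiniteDimensional.complete ℝ E
  have h1 := mvfderiv_fun_mul hf (mdifferentiableAt_inner I hY hZ)
  have h2 := mvfderiv_fun_mul hf (mdifferentiableAt_inner I hX hY)
  simp only [koszul, Pi.smul_apply', real_inner_smul_left, real_inner_smul_right, inner_add_left,
    mlieBracket_smul_left hf hY, mlieBracket_smul_right hf hY, h1, h2, add_apply, smul_apply,
    smul_eq_mul, map_smul]
  simp only [real_inner_comm (Y _)]
  ring

open scoped Classical in
/-- The bilinear form `(u, w) ↦ ⟨∇_u Y, w⟩` on the tangent space at `x`, for a vector field `Y`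
that is differentiable at `x` (and `0` otherwise). -/
def koszulForm (Y : Π x : M, TangentSpace I x) (x : M) :
    TangentSpace I x →L[ℝ] TangentSpace I x →L[ℝ] ℝ :=
  if hY : MDiffAt (T% Y) x then
    TensorialAt.mkHom₂ (fun X Z => koszul I X Y Z x) x
      (fun _ hZ => koszul_tensorial_left I hY hZ) (fun _ hX => koszul_tensorial_right I hX hY)
  else 0

theorem koszulForm_apply {X Y Z : Π x : M, TangentSpace I x} {x : M}
    (hX : MDiffAt (T% X) x) (hY : MDiffAt (T% Y) x) (hZ : MDiffAt (T% Z) x) :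
    koszulForm I Y x (X x) (Z x) = koszul I X Y Z x := by
  rw [koszulForm, dif_pos hY]
  exact TensorialAt.mkHom₂_apply (Φ := fun X Z => koszul I X Y Z x) _ _ hX hZ

instance tangentSpace_finiteDimensional (x : M) : FiniteDimensional ℝ (TangentSpace I x) :=
  inferInstanceAs (FiniteDimensional ℝ E)

instance tangentSpace_completeSpace (x : M) : CompleteSpace (TangentSpace I x) :=
  FiniteDimensional.complete ℝ (TangentSpace I x)

/-- `leviCivitaFun I Y x u` is the tangent vector `∇_u Y`, i.e. the Riesz representative of
`w ↦ ⟨∇_u Y, w⟩`. -/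
def leviCivitaFun (Y : Π x : M, TangentSpace I x) (x : M) :
    TangentSpace I x →L[ℝ] TangentSpace I x :=
  LinearMap.toContinuousLinearMap
    { toFun := fun u => (InnerProductSpace.toDual ℝ (TangentSpace I x)).symm (koszulForm I Y x u)
      map_add' := fun u v => by simp
      map_smul' := fun c u => by simp }

theorem inner_leviCivitaFun (Y : Π x : M, TangentSpace I x) (x : M) (u w : TangentSpace I x) :
    inner ℝ (leviCivitaFun I Y x u) w = koszulForm I Y x u w := by
  simp [leviCivitaFun]

/-- Two connection values agree as soon as they agree after pairing with vector fields. -/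
theorem clm_ext_inner {x : M} {A B : TangentSpace I x →L[ℝ] TangentSpace I x}
    (h : ∀ X Z : Π x : M, TangentSpace I x, MDiffAt (T% X) x → MDiffAt (T% Z) x →
      inner ℝ (A (X x)) (Z x) = inner ℝ (B (X x)) (Z x)) : A = B := by
  ext u
  refine ext_inner_right ℝ fun w => ?_
  have := h (FiberBundle.extend E u) (FiberBundle.extend E w)
    (FiberBundle.mdifferentiableAt_extend ..) (FiberBundle.mdifferentiableAt_extend ..)
  simpa using this

variable (M) in
/-- The Levi-Civita connection of the Riemannian metric on `M`. -/
def leviCivita : CovariantDerivative I E (fun x : M => TangentSpace I x) where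
  toFun := leviCivitaFun I
  isCovariantDerivativeOnUniv :=
    { add := by
        intro Y Y' x hY hY' _
        refine clm_ext_inner I fun X Z hX hZ => ?_
        have hs : MDiffAt (T% (Y + Y')) x := mdifferentiableAt_add_section hY hY'
        simp only [add_apply, inner_add_left, inner_leviCivitaFun]
        rw [koszulForm_apply I hX hs hZ, koszulForm_apply I hX hY hZ,
          koszulForm_apply I hX hY' hZ, koszul_add_middle I hX hY hY' hZ]
      leibniz := by
        intro Y f x hY hf _
        refine clm_ext_inner I fun X Z hX hZ => ?_
        have hs : MDiffAt (T% (f • Y)) x := hf.smul_section hY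
        simp only [add_apply, smul_apply, inner_add_left, inner_leviCivitaFun,
          real_inner_smul_left, ContinuousLinearMap.smulRight_apply]
        rw [koszulForm_apply I hX hs hZ, koszulForm_apply I hX hY hZ,
          koszul_smul_middle I hX hf hY hZ] }

variable (M) in
/-- The Levi-Civita connection is torsion-free. -/
theorem leviCivita_torsion [CompleteSpace E] : (leviCivita I M).torsion = 0 := by
  rw [CovariantDerivative.torsion_eq_zero_iff]
  intro X Y x hX hY
  refine ext_inner_right ℝ fun w => ?_
  have hZ : MDiffAt (T% (FiberBundle.extend E w : Π y : M, TangentSpace I y)) x :=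
    FiberBundle.mdifferentiableAt_extend ..
  have h := koszul_sub_swap I X Y (FiberBundle.extend E w) x
  rw [← koszulForm_apply I hX hY hZ, ← koszulForm_apply I hY hX hZ,
    ← inner_leviCivitaFun, ← inner_leviCivitaFun, ← inner_sub_left] at h
  simpa using! h

/-- The Levi-Civita connection is metric: `X⟨Y,Z⟩ = ⟨∇_X Y, Z⟩ + ⟨Y, ∇_X Z⟩`. -/
theorem leviCivita_metric {X Y Z : Π x : M, TangentSpace I x} {x : M}
    (hX : MDiffAt (T% X) x) (hY : MDiffAt (T% Y) x) (hZ : MDiffAt (T% Z) x) :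
    d% (fun y => inner ℝ (Y y) (Z y)) x (X x) =
      inner ℝ (leviCivita I M Y x (X x)) (Z x) + inner ℝ (Y x) (leviCivita I M Z x (X x)) := by
  have h := koszul_add_swap I X Y Z x
  rw [← koszulForm_apply I hX hY hZ, ← koszulForm_apply I hX hZ hY,
    ← inner_leviCivitaFun, ← inner_leviCivitaFun] at h
  rw [← h, real_inner_comm _ (Y x)]
  rfl

/-! ### Curvature -/

/-- The Riemann curvature `R(u,v)w = ∇_X ∇_Y Z - ∇_Y ∇_X Z - ∇_[X,Y] Z` at `x`, where `X, Y, Z`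
are smooth extensions of the tangent vectors `u, v, w` to a neighbourhood of `x`. -/
def curvature (x : M) (u v w : TangentSpace I x) : TangentSpace I x :=
  let X : Π y : M, TangentSpace I y := FiberBundle.extend E u
  let Y : Π y : M, TangentSpace I y := FiberBundle.extend E v
  let Z : Π y : M, TangentSpace I y := FiberBundle.extend E w
  leviCivita I M (fun y => leviCivita I M Z y (Y y)) x (X x)
    - leviCivita I M (fun y => leviCivita I M Z y (X y)) x (Y x)
    - leviCivita I M Z x (mlieBracket I X Y x)

/-- The Ricci curvature `Ric(v,w) = trace (u ↦ R(u,v)w)`. -/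
def ricci (x : M) (v w : TangentSpace I x) : ℝ :=
  ∑ i, inner ℝ (curvature I x (stdOrthonormalBasis ℝ (TangentSpace I x) i) v w)
    (stdOrthonormalBasis ℝ (TangentSpace I x) i)

/-- The scalar curvature, the metric trace of the Ricci curvature. -/
def scal (x : M) : ℝ :=
  ∑ i, ricci I x (stdOrthonormalBasis ℝ (TangentSpace I x) i)
    (stdOrthonormalBasis ℝ (TangentSpace I x) i)

variable (M) in
/-- The metric is Einstein: `Ric = c g` for a constant `c`. -/
def IsEinstein : Prop :=
  ∃ c : ℝ, ∀ (x : M) (v w : TangentSpace I x), ricci I x v w = c * inner ℝ v w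

/-- A Killing field: a smooth vector field `K` for which `∇K` is a skew endomorphism. -/
def IsKilling (K : Π x : M, TangentSpace I x) : Prop :=
  ContMDiff I I.tangent ∞ (T% K) ∧
    ∀ (x : M) (u v : TangentSpace I x),
      inner ℝ (leviCivita I M K x u) v = - inner ℝ u (leviCivita I M K x v)

end LeviCivita

/-! ### Hodge star and selfduality in dimension four -/

/-- The Hodge star of a two-form `α` on an oriented Euclidean four-space:
`(*α)(u,v) = ½ ∑ i j, α(e_i,e_j) vol(e_i,e_j,u,v)` for an orthonormal basis `e`. -/
def hodgeStar {V : Type*} [NormedAddCommGroup V] [InnerProductSpace ℝ V] [FiniteDimensional ℝ V]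
    [Fact (finrank ℝ V = 4)] (o : Orientation ℝ V (Fin 4)) (α : V → V → ℝ) (u v : V) : ℝ :=
  (1 / 2 : ℝ) * ∑ i, ∑ j, α (stdOrthonormalBasis ℝ V i) (stdOrthonormalBasis ℝ V j) *
    o.volumeForm ![stdOrthonormalBasis ℝ V i, stdOrthonormalBasis ℝ V j, u, v]

theorem finrank_tangentSpace {M : Type*} [TopologicalSpace M]
    [ChartedSpace (EuclideanSpace ℝ (Fin 4)) M] (x : M) :
    finrank ℝ (TangentSpace (𝓡 4) x) = 4 :=
  finrank_euclideanSpace_fin (𝕜 := ℝ) (n := 4)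

instance tangentSpace_fact_finrank {M : Type*} [TopologicalSpace M]
    [ChartedSpace (EuclideanSpace ℝ (Fin 4)) M] (x : M) :
    Fact (finrank ℝ (TangentSpace (𝓡 4) x) = 4) :=
  ⟨finrank_tangentSpace x⟩

section FourManifold

variable {M : Type*} [TopologicalSpace M] [ChartedSpace (EuclideanSpace ℝ (Fin 4)) M]
  [RiemannianBundle (fun x : M => TangentSpace (𝓡 4) x)]

/-- The orthogonal complement of the span of `K` and `K'`, at each point. -/
def orthDistribution (K K' : Π x : M, TangentSpace (𝓡 4) x) (x : M) :
    Submodule ℝ (TangentSpace (𝓡 4) x) :=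
  (Submodule.span ℝ {K x, K' x})ᗮ

variable [IsManifold (𝓡 4) ∞ M]

/-- A pointwise choice of orientations of the tangent spaces is an orientation of the manifold `M`
if every point has a neighbourhood with a positively oriented smooth frame. -/
def IsManifoldOrientation (o : Π x : M, Orientation ℝ (TangentSpace (𝓡 4) x) (Fin 4)) : Prop :=
  ∀ x : M, ∃ s : Fin 4 → Π y : M, TangentSpace (𝓡 4) y,
    (∀ i, ContMDiffAt (𝓡 4) (𝓡 4).tangent ∞ (T% (s i)) x) ∧
      ∀ᶠ y in 𝓝 x, 0 < (o y).volumeForm (fun i => s i y)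

variable [IsContMDiffRiemannianBundle (𝓡 4) ∞ (EuclideanSpace ℝ (Fin 4))
    (fun x : M => TangentSpace (𝓡 4) x)]

/-- The Weyl tensor in dimension four,
`W = R - ½ Ric ∧ g + (scal / 12) g ∧ g` with the Kulkarni-Nomizu product `∧` and
`R(u,v,w,t) = ⟨R(u,v)w,t⟩`. -/
def weyl (x : M) (u v w t : TangentSpace (𝓡 4) x) : ℝ :=
  inner ℝ (curvature (𝓡 4) x u v w) t
    - (1 / 2 : ℝ) * (ricci (𝓡 4) x u t * inner ℝ v w + ricci (𝓡 4) x v w * inner ℝ u t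
        - ricci (𝓡 4) x u w * inner ℝ v t - ricci (𝓡 4) x v t * inner ℝ u w)
    + scal (𝓡 4) x / 6 * (inner ℝ u t * inner ℝ v w - inner ℝ u w * inner ℝ v t)

/-- The metric is selfdual with respect to the orientation `o`: the Weyl curvature satisfies
`*W = W`, i.e. its antiselfdual part vanishes. -/
def IsSelfdual (o : Π x : M, Orientation ℝ (TangentSpace (𝓡 4) x) (Fin 4)) : Prop :=
  ∀ (x : M) (u v w t : TangentSpace (𝓡 4) x),
    hodgeStar (o x) (fun a b => weyl x a b w t) u v = weyl x u v w t

/-- The scalar `(*∇L)(K, K')`, where `∇L` is viewed as the two-form `(u,v) ↦ ⟨∇_u L, v⟩`. The twist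
scalars of the pair `K, K'` are its values for `L = K` and for `L = K'`. -/
def twistScalar (o : Π x : M, Orientation ℝ (TangentSpace (𝓡 4) x) (Fin 4))
    (K K' L : Π x : M, TangentSpace (𝓡 4) x) (x : M) : ℝ :=
  hodgeStar (o x) (fun u v => inner ℝ (leviCivita (𝓡 4) M L x u) v) (K x) (K' x)

end FourManifold

/-- Integrability over the open set `U` of a distribution of two-planes `D`: through every point
of `U` there passes an integral surface, i.e. a smoothly immersed surface in `U` whose tangent
planes are the planes of `D`. -/
def IsIntegrableOn {M : Type*} [TopologicalSpace M] [ChartedSpace (EuclideanSpace ℝ (Fin 4)) M]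
    (D : Π x : M, Submodule ℝ (TangentSpace (𝓡 4) x)) (U : Set M) : Prop :=
  ∀ x ∈ U, ∃ (S : Set (EuclideanSpace ℝ (Fin 2))) (φ : EuclideanSpace ℝ (Fin 2) → M),
    IsOpen S ∧ 0 ∈ S ∧ φ 0 = x ∧ ContMDiffOn (𝓡 2) (𝓡 4) ∞ φ S ∧
      ∀ p ∈ S, φ p ∈ U ∧ Function.Injective (mfderiv (𝓡 2) (𝓡 4) φ p) ∧
        (mfderiv (𝓡 2) (𝓡 4) φ p).range = D (φ p)

end SelfdualEinstein

end

/-!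
Write `A = ∇K` and `A' = ∇K'`, which are skew endomorphisms of the tangent spaces.

*The twist scalars.* Commuting Killing fields satisfy `A K' = A' K`. Differentiating this relation,
and using Kostant's identity `∇²_{X,Y} K = R(X,K)Y` and the first Bianchi identity, gives
`R(K,K') = [A,A']` (`IsKilling.inner_curvature`). By the pair symmetry of the curvature, the same
two-form is `W(·,·,K,K')` plus `c / 3` times `K ∧ K'`, up to sign. Selfduality kills the
antiselfdual part of the Weyl term, so the antiselfdual part of `K ∧ K'` is a nonzero multiple of
the antiselfdual part of `[A,A']`; here `c ≠ 0` because the scalar curvature is `4 c`. The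
antiselfdual part of a commutator is the vector product of the antiselfdual parts, hence is
orthogonal to both of them, so the antiselfdual parts of the two-forms `A` and `A'` vanish on
`K, K'`. The forms themselves vanish on `K, K'` because the fields are Killing and commute.
Therefore `*A` and `*A'` vanish on `K, K'`
(`hodgeStar_eq_zero_of_selfdual_commutator`, `twistScalar_eq_zero`).

*Integrability.* Where `K, K'` are linearly independent, the vanishing of `(*A)(K,K')` means that
`A` vanishes on the orthogonal complement of `K, K'`
(`inner_apply_eq_zero_of_hodgeStar_eq_zero`). General Frobenius theory is not needed, because the
distribution is the common kernel of two *closed* forms: let `θ, θ'` be the forms that vanish on the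
complement and are dual to `K, K'`. The exterior derivative of
`⟨K,·⟩ = ⟨K,K⟩ θ + ⟨K,K'⟩ θ'` is `2 A`, where `A` is viewed as a two-form, and `2 A` equals
`d⟨K,K⟩ ∧ θ + d⟨K,K'⟩ ∧ θ'` since `A` vanishes on the complement and on `K, K'`. What remains is
`⟨K,K⟩ dθ + ⟨K,K'⟩ dθ' = 0`, together with the same identity for `K'`, and the Gram matrix of
`K, K'` is invertible (`IsKilling.mvfderiv_dualForm_comm`). By the Poincaré lemma in a coordinate
ball the two forms have potentials (`IsKilling.exists_potential`), and the common level sets of the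
potentials, parametrized by the inverse function theorem
(`exists_immersion_of_surjective_fderiv`), are the integral surfaces.
-/

noncomputable section

namespace SelfdualEinstein

/-! ### Smoothness of derivatives and of the Levi-Civita connection -/

section Smoothness

variable {E : Type*} [NormedAddCommGroup E] [NormedSpace ℝ E]
  {H : Type*} [TopologicalSpace H] {I : ModelWithCorners ℝ E H}
  {M : Type*} [TopologicalSpace M] [ChartedSpace H M] [IsManifold I ∞ M]

/-- The derivative of a smooth function along a smooth vector field is smooth: it is the fibre
component of the tangent map composed with the vector field. -/
theorem contMDiffAt_mvfderiv_apply {f : M → ℝ} {X : Π x : M, TangentSpace I x} {x : M}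
    (hf : CMDiffAt ∞ f x) (hX : CMDiffAt ∞ (T% X) x) :
    CMDiffAt ∞ (fun y => d% f y (X y)) x := by
  rw [contMDiffAt_infty]
  intro n
  have hf' : CMDiffAt ((n + 1 : ℕ) : ℕ∞ω) f x := hf.of_le (by exact_mod_cast le_top)
  rw [contMDiffAt_iff_contMDiffOn_nhds (by simp)] at hf'
  obtain ⟨u, hu, hfu⟩ := hf'
  obtain ⟨v, hvu, hv, hxv⟩ := mem_nhds_iff.1 hu
  have h1 := (hfu.mono hvu).contMDiffOn_tangentMapWithin (m := n) (by norm_cast) hv.uniqueMDiffOn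
  have h2 : CMDiffAt n (fun y => tangentMapWithin I 𝓘(ℝ, ℝ) f v (T% X y)) x :=
    (h1.contMDiffAt ((hv.preimage
      (FiberBundle.continuous_proj E (fun x : M => TangentSpace I x))).mem_nhds hxv)).comp x
        (hX.of_le (by exact_mod_cast le_top))
  have h3 := (contMDiff_snd_tangentBundle_modelSpace ℝ 𝓘(ℝ, ℝ) (n := n)).contMDiffAt.comp x h2
  refine h3.congr_of_eventuallyEq ?_
  filter_upwards [hv.mem_nhds hxv] with y hy
  change mfderiv I 𝓘(ℝ, ℝ) f y (X y) = mfderivWithin I 𝓘(ℝ, ℝ) f v y (X y)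
  rw [mfderivWithin_of_isOpen hv hy]

theorem eventually_mdifferentiableAt {X : Π x : M, TangentSpace I x} {x : M}
    (hX : CMDiffAt ∞ (T% X) x) : ∀ᶠ y in 𝓝 x, MDiffAt (T% X) y := by
  have h1 : CMDiffAt 1 (T% X) x := hX.of_le (by exact_mod_cast le_top)
  filter_upwards [(contMDiffAt_iff_contMDiffAt_nhds (by simp)).1 h1] with y hy
  exact hy.mdifferentiableAt one_ne_zero

variable (I M) in
theorem isManifold_minSmoothness (n : ℕ∞ω) [hn : ENat.LEInfty n] :
    IsManifold I (minSmoothness ℝ n) M :=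
  .of_le (n := ∞) (by simpa using hn.out)

theorem contMDiffAt_mlieBracket [CompleteSpace E] {X Y : Π x : M, TangentSpace I x} {x : M}
    (hX : CMDiffAt ∞ (T% X) x) (hY : CMDiffAt ∞ (T% Y) x) :
    CMDiffAt ∞ (T% (mlieBracket I X Y)) x := by
  have := isManifold_minSmoothness I M 2
  have : IsManifold I ((⊤ : ℕ∞) + 1) M := inferInstanceAs (IsManifold I ∞ M)
  exact ContMDiffAt.mlieBracket_vectorField (m := ⊤) (n := ⊤) hX hY (by simp)

theorem contMDiffAt_inner [RiemannianBundle (fun x : M => TangentSpace I x)]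
    [IsContMDiffRiemannianBundle I ∞ E (fun x : M => TangentSpace I x)]
    {X Y : Π x : M, TangentSpace I x} {x : M}
    (hX : CMDiffAt ∞ (T% X) x) (hY : CMDiffAt ∞ (T% Y) x) :
    CMDiffAt ∞ (fun y => inner ℝ (X y) (Y y)) x :=
  ContMDiffAt.inner_bundle (E := fun x : M => TangentSpace I x) (b := fun y => y) hX hY

/-- A tangent vector field is smooth as soon as its inner products with smooth vector fields are.
Its coefficients in a local frame are obtained from these products by Cramer's rule applied to the
Gram matrix of the frame. -/
theorem contMDiffAt_of_inner [FiniteDimensional ℝ E]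
    [RiemannianBundle (fun x : M => TangentSpace I x)]
    [IsContMDiffRiemannianBundle I ∞ E (fun x : M => TangentSpace I x)]
    {V : Π x : M, TangentSpace I x} {x : M}
    (h : ∀ Z : Π x : M, TangentSpace I x, CMDiffAt ∞ (T% Z) x →
      CMDiffAt ∞ (fun y => inner ℝ (V y) (Z y)) x) :
    CMDiffAt ∞ (T% V) x := by
  classical
  let t := trivializationAt E (TangentSpace I : M → Type _) x
  have hxt : x ∈ t.baseSet := FiberBundle.mem_baseSet_trivializationAt E (TangentSpace I) x
  let b := finBasis ℝ E
  let s := t.localFrame b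
  have hs : IsLocalFrameOn I E ∞ s t.baseSet := t.isLocalFrameOn_localFrame_baseSet I ∞ b
  have hsm : ∀ i, CMDiffAt ∞ (T% (s i)) x := fun i => hs.contMDiffAt t.open_baseSet hxt i
  refine hs.contMDiffAt_of_coeff (fun i => ?_) (t.open_baseSet.mem_nhds hxt)
  let G : M → Matrix (Fin (finrank ℝ E)) (Fin (finrank ℝ E)) ℝ := fun y => Matrix.gram ℝ (s · y)
  have hdet : ∀ N : M → Matrix (Fin (finrank ℝ E)) (Fin (finrank ℝ E)) ℝ,
      (∀ i j, CMDiffAt ∞ (fun y => N y i j) x) → CMDiffAt ∞ (fun y => (N y).det) x := by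
    intro N hN
    simp only [Matrix.det_apply']
    exact contMDiffAt_finsetSum fun σ _ =>
      contMDiffAt_const.mul (contMDiffAt_finsetProd fun j _ => hN _ _)
  have hG : ∀ i j, CMDiffAt ∞ (fun y => G y i j) x := fun i j =>
    contMDiffAt_inner (hsm i) (hsm j)
  have hG0 : ∀ y ∈ t.baseSet, (G y).det ≠ 0 := fun y hy =>
    (Matrix.posDef_gram_of_linearIndependent (hs.linearIndependent hy)).det_pos.ne'
  have hc : CMDiffAt ∞ (fun y => ((G y).updateCol i fun j => inner ℝ (V y) (s j y)).det /
      (G y).det) x := by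
    refine ContMDiffAt.div₀ (hdet _ fun k j => ?_) (hdet _ hG) (hG0 x hxt)
    by_cases hj : j = i
    · subst hj
      simpa using h _ (hsm k)
    · simpa [Matrix.updateCol_ne hj] using hG k j
  refine hc.congr_of_eventuallyEq ?_
  filter_upwards [t.open_baseSet.mem_nhds hxt] with y hy
  have h1 : (fun j => inner ℝ (V y) (s j y)) =
      (G y).mulVec (fun j => hs.coeff j y (V y)) := by
    ext j
    rw [real_inner_comm]
    conv_lhs => rw [hs.coeff_sum_eq V hy]
    rw [inner_sum]
    exact Finset.sum_congr rfl fun k _ => by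
      rw [real_inner_smul_right, mul_comm]
      rfl
  rw [eq_div_iff (hG0 y hy), h1, ← Matrix.cramer_apply, Matrix.cramer_eq_adjugate_mulVec,
    Matrix.mulVec_mulVec, Matrix.adjugate_mul]
  rw [Matrix.smul_mulVec, Matrix.one_mulVec, Pi.smul_apply, smul_eq_mul, mul_comm]
  rfl

variable [FiniteDimensional ℝ E] [RiemannianBundle (fun x : M => TangentSpace I x)]
    [IsContMDiffRiemannianBundle I ∞ E (fun x : M => TangentSpace I x)]

theorem contMDiffAt_koszul {X Y Z : Π x : M, TangentSpace I x} {x : M}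
    (hX : CMDiffAt ∞ (T% X) x) (hY : CMDiffAt ∞ (T% Y) x) (hZ : CMDiffAt ∞ (T% Z) x) :
    CMDiffAt ∞ (koszul I X Y Z) x := by
  have := FiniteDimensional.complete ℝ E
  unfold koszul
  refine contMDiffAt_const.mul (((((ContMDiffAt.add ?_ ?_).sub ?_).add ?_).sub ?_).sub ?_)
  · exact contMDiffAt_mvfderiv_apply (contMDiffAt_inner hY hZ) hX
  · exact contMDiffAt_mvfderiv_apply (contMDiffAt_inner hX hZ) hY
  · exact contMDiffAt_mvfderiv_apply (contMDiffAt_inner hX hY) hZ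
  · exact contMDiffAt_inner (contMDiffAt_mlieBracket hX hY) hZ
  · exact contMDiffAt_inner (contMDiffAt_mlieBracket hX hZ) hY
  · exact contMDiffAt_inner (contMDiffAt_mlieBracket hY hZ) hX

theorem inner_leviCivita {X Y Z : Π x : M, TangentSpace I x} {x : M}
    (hX : MDiffAt (T% X) x) (hY : MDiffAt (T% Y) x) (hZ : MDiffAt (T% Z) x) :
    inner ℝ (leviCivita I M Y x (X x)) (Z x) = koszul I X Y Z x := by
  rw [← koszulForm_apply I hX hY hZ, ← inner_leviCivitaFun]
  rfl

theorem contMDiffAt_leviCivita {X Y : Π x : M, TangentSpace I x} {x : M}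
    (hX : CMDiffAt ∞ (T% X) x) (hY : CMDiffAt ∞ (T% Y) x) :
    CMDiffAt ∞ (T% (fun y => leviCivita I M Y y (X y))) x := by
  refine contMDiffAt_of_inner fun Z hZ => (contMDiffAt_koszul hX hY hZ).congr_of_eventuallyEq ?_
  filter_upwards [eventually_mdifferentiableAt hX, eventually_mdifferentiableAt hY,
    eventually_mdifferentiableAt hZ] with y h1 h2 h3
  exact inner_leviCivita h1 h2 h3

/-- Differentiability of `∇_X Y` when `Y` is smooth but `X` only differentiable: expand `X` in a
smooth local frame and use that `∇_X Y` is linear in `X`. -/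
theorem mdifferentiableAt_leviCivita {X Y : Π x : M, TangentSpace I x} {x : M}
    (hX : MDiffAt (T% X) x) (hY : CMDiffAt ∞ (T% Y) x) :
    MDiffAt (T% (fun y => leviCivita I M Y y (X y))) x := by
  let t := trivializationAt E (TangentSpace I : M → Type _) x
  have hxt : x ∈ t.baseSet := FiberBundle.mem_baseSet_trivializationAt E (TangentSpace I) x
  let b := finBasis ℝ E
  have hs : IsLocalFrameOn I E ∞ (t.localFrame b) t.baseSet :=
    t.isLocalFrameOn_localFrame_baseSet I ∞ b
  have h1 : ∀ i, MDiffAt (T% (fun y => leviCivita I M Y y (t.localFrame b i y))) x := fun i =>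
    (contMDiffAt_leviCivita (hs.contMDiffAt t.open_baseSet hxt i) hY).mdifferentiableAt (by simp)
  have h2 : MDiffAt (T% (fun y => ∑ i, t.localFrameCoeff I b i y (X y) •
      leviCivita I M Y y (t.localFrame b i y))) x :=
    .sum_section fun i _ => (mdifferentiableAt_localFrameCoeff b hxt hX i).smul_section (h1 i)
  refine h2.congr_of_eventuallyEq ?_
  filter_upwards [t.open_baseSet.mem_nhds hxt] with y hy
  congr 1
  conv_lhs => rw [t.eq_sum_localFrameCoeff_smul (I := I) (b := b) (s := X) hy]
  simp

end Smoothness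

/-! ### Curvature of vector fields -/

section CurvatureOfFields

variable {E : Type*} [NormedAddCommGroup E] [NormedSpace ℝ E]
  {H : Type*} [TopologicalSpace H] {I : ModelWithCorners ℝ E H}
  {M : Type*} [TopologicalSpace M] [ChartedSpace H M]

theorem mvfderiv_congr {f g : M → ℝ} {x : M} (h : f =ᶠ[𝓝 x] g) (u : TangentSpace I x) :
    d% f x u = d% g x u := by
  change mfderiv I 𝓘(ℝ, ℝ) f x u = mfderiv I 𝓘(ℝ, ℝ) g x u
  rw [h.mfderiv_eq]
  rfl

variable [IsManifold I ∞ M]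

/-- The Lie bracket acts on functions as the commutator of derivations. This is the coefficient of
`Z` in the Jacobi identity for `X, Y, f • Z`. -/
theorem mvfderiv_mlieBracket [FiniteDimensional ℝ E] {X Y : Π x : M, TangentSpace I x}
    {f : M → ℝ} {x : M}
    (hX : CMDiffAt ∞ (T% X) x) (hY : CMDiffAt ∞ (T% Y) x) (hf : CMDiffAt ∞ f x) :
    d% f x (mlieBracket I X Y x) =
      d% (fun y => d% f y (Y y)) x (X x) - d% (fun y => d% f y (X y)) x (Y x) := by
  have := FiniteDimensional.complete ℝ E
  have := isManifold_minSmoothness I M 3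
  rcases subsingleton_or_nontrivial E with hE | hE
  · have h0 : ∀ u : TangentSpace I x, u = 0 := fun u => Subsingleton.elim (α := E) _ _
    rw [h0 (X x), h0 (Y x), h0 (mlieBracket I X Y x)]
    simp
  obtain ⟨w, hw⟩ := exists_ne (0 : E)
  let Z : Π y : M, TangentSpace I y := FiberBundle.extend E (show TangentSpace I x from w)
  have hZ : CMDiffAt ∞ (T% Z) x := FiberBundle.contMDiffAt_extend ..
  have hZx : Z x = w := FiberBundle.extend_apply_self ..
  have two_le : minSmoothness ℝ 2 ≤ (∞ : ℕ∞ω) := by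
    simpa using ENat.LEInfty.out
  have hff : ∀ᶠ y in 𝓝 x, MDiffAt f y := by
    have h1 : CMDiffAt 1 f x := hf.of_le (by exact_mod_cast le_top)
    filter_upwards [(contMDiffAt_iff_contMDiffAt_nhds (by simp)).1 h1] with y hy
    exact hy.mdifferentiableAt one_ne_zero
  have hfZ : CMDiffAt ∞ (T% (f • Z)) x := hf.smul_section hZ
  have key : ∀ {X Y : Π x : M, TangentSpace I x}, CMDiffAt ∞ (T% X) x → CMDiffAt ∞ (T% Y) x →
      mlieBracket I X (mlieBracket I Y (f • Z)) x =
        d% (fun y => d% f y (Y y)) x (X x) • Z x + d% f x (Y x) • mlieBracket I X Z x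
        + (d% f x (X x) • mlieBracket I Y Z x + f x • mlieBracket I X (mlieBracket I Y Z) x) := by
    intro X Y hX hY
    have e1 : mlieBracket I Y (f • Z) =ᶠ[𝓝 x]
        (fun y => d% f y (Y y)) • Z + f • mlieBracket I Y Z := by
      filter_upwards [hff, eventually_mdifferentiableAt hZ] with y h1 h2
      exact mlieBracket_smul_right h1 h2
    have h1 := contMDiffAt_mvfderiv_apply hf hY
    have h2 := contMDiffAt_mlieBracket hY hZ
    refine (Filter.EventuallyEq.mlieBracket_vectorField_eq (.refl (𝓝 x) X) e1).trans ?_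
    rw [mlieBracket_add_right
        ((h1.mdifferentiableAt (by simp)).smul_section (hZ.mdifferentiableAt (by simp)))
        ((hf.mdifferentiableAt (by simp)).smul_section (h2.mdifferentiableAt (by simp))),
      mlieBracket_smul_right (h1.mdifferentiableAt (by simp)) (hZ.mdifferentiableAt (by simp)),
      mlieBracket_smul_right (hf.mdifferentiableAt (by simp)) (h2.mdifferentiableAt (by simp))]
  have j1 := leibniz_identity_mlieBracket_apply (hX.of_le two_le) (hY.of_le two_le)
    (hfZ.of_le two_le)
  have j2 := leibniz_identity_mlieBracket_apply (hX.of_le two_le) (hY.of_le two_le)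
    (hZ.of_le two_le)
  rw [key hX hY, key hY hX, mlieBracket_smul_right (hf.mdifferentiableAt (by simp))
    (hZ.mdifferentiableAt (by simp)), j2] at j1
  have h3 : (d% f x (mlieBracket I X Y x) -
      (d% (fun y => d% f y (Y y)) x (X x) - d% (fun y => d% f y (X y)) x (Y x))) • Z x = 0 := by
    linear_combination (norm := module) -j1
  rw [hZx] at h3
  exact sub_eq_zero.1 ((smul_eq_zero.1 h3).resolve_right hw)

variable [FiniteDimensional ℝ E] [RiemannianBundle (fun x : M => TangentSpace I x)]
    [IsContMDiffRiemannianBundle I ∞ E (fun x : M => TangentSpace I x)]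

/-- The vector field `∇_X Y`. -/
def nabla (X Y : Π x : M, TangentSpace I x) : Π x : M, TangentSpace I x :=
  fun y => leviCivita I M Y y (X y)

theorem contMDiffAt_nabla {X Y : Π x : M, TangentSpace I x} {x : M}
    (hX : CMDiffAt ∞ (T% X) x) (hY : CMDiffAt ∞ (T% Y) x) : CMDiffAt ∞ (T% (nabla X Y)) x :=
  contMDiffAt_leviCivita hX hY

theorem nabla_congr {X Y Y' : Π x : M, TangentSpace I x} {x : M} (hY : CMDiffAt ∞ (T% Y) x)
    (hY' : CMDiffAt ∞ (T% Y') x) (h : Y =ᶠ[𝓝 x] Y') : nabla X Y x = nabla X Y' x := by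
  unfold nabla
  rw [(leviCivita I M).isCovariantDerivativeOnUniv.congr_of_eventuallyEq
    (hY.mdifferentiableAt (by simp)) (hY'.mdifferentiableAt (by simp)) Filter.univ_mem h]

theorem nabla_sub_nabla {X Y : Π x : M, TangentSpace I x} {x : M}
    (hX : MDiffAt (T% X) x) (hY : MDiffAt (T% Y) x) :
    nabla X Y x - nabla Y X x = mlieBracket I X Y x := by
  have := FiniteDimensional.complete ℝ E
  exact (CovariantDerivative.torsion_eq_zero_iff _).1 (leviCivita_torsion I M) hX hY

theorem nabla_add {X Y Y' : Π x : M, TangentSpace I x} {x : M}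
    (hY : CMDiffAt ∞ (T% Y) x) (hY' : CMDiffAt ∞ (T% Y') x) :
    nabla X (Y + Y') x = nabla X Y x + nabla X Y' x := by
  unfold nabla
  rw [(leviCivita I M).isCovariantDerivativeOnUniv.add
    (hY.mdifferentiableAt (by simp)) (hY'.mdifferentiableAt (by simp))]
  rfl

theorem nabla_sub {X Y Y' : Π x : M, TangentSpace I x} {x : M}
    (hY : CMDiffAt ∞ (T% Y) x) (hY' : CMDiffAt ∞ (T% Y') x) :
    nabla X (Y - Y') x = nabla X Y x - nabla X Y' x := by
  rw [eq_sub_iff_add_eq, ← nabla_add (hY.sub_section hY') hY', sub_add_cancel]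

theorem mvfderiv_inner {X Y Z : Π x : M, TangentSpace I x} {x : M}
    (hX : MDiffAt (T% X) x) (hY : MDiffAt (T% Y) x) (hZ : MDiffAt (T% Z) x) :
    d% (fun y => inner ℝ (Y y) (Z y)) x (X x) =
      inner ℝ (nabla X Y x) (Z x) + inner ℝ (Y x) (nabla X Z x) :=
  leviCivita_metric I hX hY hZ

/-- The vector field `R(X,Y)Z = ∇_X ∇_Y Z - ∇_Y ∇_X Z - ∇_[X,Y] Z`. -/
def curvatureField (X Y Z : Π x : M, TangentSpace I x) : Π x : M, TangentSpace I x :=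
  fun x => nabla X (nabla Y Z) x - nabla Y (nabla X Z) x - nabla (mlieBracket I X Y) Z x

theorem curvatureField_swap (X Y Z : Π x : M, TangentSpace I x) (x : M) :
    curvatureField X Y Z x = - curvatureField Y X Z x := by
  have h : mlieBracket I X Y x = - mlieBracket I Y X x := mlieBracket_swap_apply
  simp only [curvatureField, nabla, h, map_neg]
  abel

/-- The curvature acts by skew endomorphisms: expand both sides of
`[X,Y]⟨Z,W⟩ = X(Y⟨Z,W⟩) - Y(X⟨Z,W⟩)` by metricity of the connection. -/
theorem inner_curvatureField_swap {X Y Z W : Π x : M, TangentSpace I x} {x : M}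
    (hX : CMDiffAt ∞ (T% X) x) (hY : CMDiffAt ∞ (T% Y) x) (hZ : CMDiffAt ∞ (T% Z) x)
    (hW : CMDiffAt ∞ (T% W) x) :
    inner ℝ (curvatureField X Y Z x) (W x) = - inner ℝ (curvatureField X Y W x) (Z x) := by
  have := FiniteDimensional.complete ℝ E
  have ev := fun {X : Π x : M, TangentSpace I x} (h : CMDiffAt ∞ (T% X) x) =>
    eventually_mdifferentiableAt h
  have md := fun {X : Π x : M, TangentSpace I x} (h : CMDiffAt ∞ (T% X) x) =>
    h.mdifferentiableAt (by simp)
  have second : ∀ {X Y : Π x : M, TangentSpace I x}, CMDiffAt ∞ (T% X) x → CMDiffAt ∞ (T% Y) x →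
      d% (fun y => d% (fun z => inner ℝ (Z z) (W z)) y (Y y)) x (X x) =
        inner ℝ (nabla X (nabla Y Z) x) (W x) + inner ℝ (nabla Y Z x) (nabla X W x)
        + (inner ℝ (nabla X Z x) (nabla Y W x) + inner ℝ (Z x) (nabla X (nabla Y W) x)) := by
    intro X Y hX hY
    have e : (fun y => d% (fun z => inner ℝ (Z z) (W z)) y (Y y)) =ᶠ[𝓝 x]
        (fun y => inner ℝ (nabla Y Z y) (W y)) + (fun y => inner ℝ (Z y) (nabla Y W y)) := by
      filter_upwards [ev hY, ev hZ, ev hW] with y h1 h2 h3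
      exact mvfderiv_inner h1 h2 h3
    have hYZ := contMDiffAt_nabla hY hZ
    have hYW := contMDiffAt_nabla hY hW
    rw [mvfderiv_congr e, mvfderiv_add (mdifferentiableAt_inner I (md hYZ) (md hW))
      (mdifferentiableAt_inner I (md hZ) (md hYW)), add_apply,
      mvfderiv_inner (md hX) (md hYZ) (md hW), mvfderiv_inner (md hX) (md hZ) (md hYW)]
  have h := mvfderiv_mlieBracket hX hY (contMDiffAt_inner hZ hW)
  rw [second hX hY, second hY hX,
    mvfderiv_inner (md (contMDiffAt_mlieBracket hX hY)) (md hZ) (md hW)] at h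
  rw [real_inner_comm (Z x)]
  simp only [curvatureField, inner_sub_left, inner_sub_right]
  linarith

/-- The first Bianchi identity; for a torsion-free connection it is the Jacobi identity. -/
theorem curvatureField_cyclic {X Y Z : Π x : M, TangentSpace I x} {x : M}
    (hX : CMDiffAt ∞ (T% X) x) (hY : CMDiffAt ∞ (T% Y) x) (hZ : CMDiffAt ∞ (T% Z) x) :
    curvatureField X Y Z x + curvatureField Y Z X x + curvatureField Z X Y x = 0 := by
  have := FiniteDimensional.complete ℝ E
  have := isManifold_minSmoothness I M 3
  have md := fun {X : Π x : M, TangentSpace I x} (h : CMDiffAt ∞ (T% X) x) =>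
    h.mdifferentiableAt (by simp)
  have two_le : minSmoothness ℝ 2 ≤ (∞ : ℕ∞ω) := by
    simpa using ENat.LEInfty.out
  have key : ∀ {X Y Z : Π x : M, TangentSpace I x}, CMDiffAt ∞ (T% X) x → CMDiffAt ∞ (T% Y) x →
      CMDiffAt ∞ (T% Z) x → nabla X (nabla Y Z) x - nabla X (nabla Z Y) x -
        nabla (mlieBracket I Y Z) X x = mlieBracket I X (mlieBracket I Y Z) x := by
    intro X Y Z hX hY hZ
    have hYZ := contMDiffAt_mlieBracket hY hZ
    rw [← nabla_sub_nabla (md hX) (md hYZ), ← nabla_sub (contMDiffAt_nabla hY hZ)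
      (contMDiffAt_nabla hZ hY), nabla_congr ((contMDiffAt_nabla hY hZ).sub_section
      (contMDiffAt_nabla hZ hY)) hYZ]
    filter_upwards [eventually_mdifferentiableAt hY, eventually_mdifferentiableAt hZ] with y h1 h2
    exact nabla_sub_nabla h1 h2
  have h1 := key hX hY hZ
  have h2 := key hY hZ hX
  have h3 := key hZ hX hY
  have j := leibniz_identity_mlieBracket_apply (hX.of_le two_le) (hY.of_le two_le)
    (hZ.of_le two_le)
  have s1 : mlieBracket I (mlieBracket I X Y) Z x = - mlieBracket I Z (mlieBracket I X Y) x :=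
    mlieBracket_swap_apply
  have s2 : mlieBracket I Y (mlieBracket I X Z) x = - mlieBracket I Y (mlieBracket I Z X) x := by
    rw [mlieBracket_swap (V := X) (W := Z), ← neg_one_smul ℝ (mlieBracket I Z X),
      mlieBracket_const_smul_right (md (contMDiffAt_mlieBracket hZ hX)), neg_one_smul]
  simp only [curvatureField]
  rw [s1, s2] at j
  linear_combination (norm := module) h1 + h2 + h3 + j

/-- The pair symmetry of the curvature, from its skew-symmetries and the Bianchi identity. -/
theorem inner_curvatureField_comm {X Y Z W : Π x : M, TangentSpace I x} {x : M}
    (hX : CMDiffAt ∞ (T% X) x) (hY : CMDiffAt ∞ (T% Y) x) (hZ : CMDiffAt ∞ (T% Z) x)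
    (hW : CMDiffAt ∞ (T% W) x) :
    inner ℝ (curvatureField X Y Z x) (W x) = inner ℝ (curvatureField Z W X x) (Y x) := by
  have bi : ∀ {X Y Z W : Π x : M, TangentSpace I x}, CMDiffAt ∞ (T% X) x → CMDiffAt ∞ (T% Y) x →
      CMDiffAt ∞ (T% Z) x → inner ℝ (curvatureField X Y Z x) (W x) +
        inner ℝ (curvatureField Y Z X x) (W x) + inner ℝ (curvatureField Z X Y x) (W x) = 0 := by
    intro X Y Z W hX hY hZ
    rw [← inner_add_left, ← inner_add_left, curvatureField_cyclic hX hY hZ, inner_zero_left]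
  have sw : ∀ X Y Z W : Π x : M, TangentSpace I x, inner ℝ (curvatureField X Y Z x) (W x) =
      - inner ℝ (curvatureField Y X Z x) (W x) := by
    intro X Y Z W
    rw [curvatureField_swap, inner_neg_left]
  linarith [bi (W := W) hX hY hZ, bi (W := X) hY hZ hW, bi (W := Y) hZ hW hX, bi (W := Z) hW hX hY,
    inner_curvatureField_swap hX hY hZ hW, inner_curvatureField_swap hX hZ hY hW,
    inner_curvatureField_swap hX hW hY hZ, inner_curvatureField_swap hY hZ hX hW,
    inner_curvatureField_swap hY hW hX hZ, inner_curvatureField_swap hZ hW hX hY,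
    sw X Y Z W, sw X Y W Z, sw X Z Y W, sw X Z W Y, sw X W Y Z, sw X W Z Y, sw Y Z X W,
    sw Y Z W X, sw Y W X Z, sw Y W Z X, sw Z W X Y, sw Z W Y X]

/-- Tensoriality in the first argument. The predicate `TensorialAt` tests on fields that are merely
differentiable at `x`; in this argument they are differentiated only once. -/
theorem curvatureField_tensorial_left {Y Z : Π x : M, TangentSpace I x} {x : M}
    (hZ : CMDiffAt ∞ (T% Z) x) : TensorialAt I E (fun X => curvatureField X Y Z x) x where
  smul {f X} hf hX := by
    have := FiniteDimensional.complete ℝ E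
    have h1 : nabla (f • X) Z = f • nabla X Z := by
      ext y; simp [nabla]
    have h2 : MDiffAt (T% (nabla X Z)) x := mdifferentiableAt_leviCivita hX hZ
    have h3 := (leviCivita I M).isCovariantDerivativeOnUniv.leibniz h2 hf
    simp only [curvatureField, h1]
    simp only [nabla, Pi.smul_apply', mlieBracket_smul_left hf hX, map_smul, map_add] at h3 ⊢
    rw [h3]
    simp
    module
  add {X X'} hX hX' := by
    have := FiniteDimensional.complete ℝ E
    have h1 : nabla (X + X') Z = nabla X Z + nabla X' Z := by
      ext y; simp [nabla]
    have h2 : MDiffAt (T% (nabla X Z)) x := mdifferentiableAt_leviCivita hX hZ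
    have h2' : MDiffAt (T% (nabla X' Z)) x := mdifferentiableAt_leviCivita hX' hZ
    have h3 := (leviCivita I M).isCovariantDerivativeOnUniv.add h2 h2'
    simp only [curvatureField, h1]
    simp only [nabla, Pi.add_apply, mlieBracket_add_left hX hX', map_add] at h3 ⊢
    rw [h3]
    simp
    module

/-- The curvature tensor may be computed with any smooth extensions of the three vectors. It is
tensorial in the first argument, and the other arguments are moved there by the symmetries. -/
theorem curvature_apply {X Y Z : Π x : M, TangentSpace I x} {x : M}
    (hX : CMDiffAt ∞ (T% X) x) (hY : CMDiffAt ∞ (T% Y) x) (hZ : CMDiffAt ∞ (T% Z) x) :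
    curvature I x (X x) (Y x) (Z x) = curvatureField X Y Z x := by
  have congr_left : ∀ {X X' Y Z : Π x : M, TangentSpace I x}, CMDiffAt ∞ (T% X) x →
      CMDiffAt ∞ (T% X') x → CMDiffAt ∞ (T% Y) x → CMDiffAt ∞ (T% Z) x → X x = X' x →
      curvatureField X Y Z x = curvatureField X' Y Z x := fun hX hX' hY hZ h =>
    (curvatureField_tensorial_left hZ).pointwise (hX.mdifferentiableAt (by simp))
      (hX'.mdifferentiableAt (by simp)) h
  have ext : ∀ u : TangentSpace I x,
      CMDiffAt ∞ (T% (FiberBundle.extend E u : Π y : M, TangentSpace I y)) x := fun u =>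
    FiberBundle.contMDiffAt_extend ..
  change curvatureField (FiberBundle.extend E (X x)) (FiberBundle.extend E (Y x))
    (FiberBundle.extend E (Z x)) x = _
  rw [congr_left (ext (X x)) hX (ext (Y x)) (ext (Z x)) (by simp), curvatureField_swap,
    congr_left (ext (Y x)) hY hX (ext (Z x)) (by simp), curvatureField_swap, neg_neg]
  refine ext_inner_right ℝ fun w => ?_
  have hw : w = (FiberBundle.extend E w : Π y : M, TangentSpace I y) x := by simp
  rw [hw, inner_curvatureField_comm hX hY (ext (Z x)) (ext w),
    congr_left (ext (Z x)) hZ (ext w) hX (by simp), ← inner_curvatureField_comm hX hY hZ (ext w)]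

end CurvatureOfFields

/-! ### Killing fields -/

section Killing

variable {E : Type*} [NormedAddCommGroup E] [NormedSpace ℝ E]
  {H : Type*} [TopologicalSpace H] {I : ModelWithCorners ℝ E H}
  {M : Type*} [TopologicalSpace M] [ChartedSpace H M] [IsManifold I ∞ M]
  [FiniteDimensional ℝ E] [RiemannianBundle (fun x : M => TangentSpace I x)]
  [IsContMDiffRiemannianBundle I ∞ E (fun x : M => TangentSpace I x)]

theorem contMDiffAt_extend_tangent {x : M} (u : TangentSpace I x) :
    CMDiffAt ∞ (T% (FiberBundle.extend E u : Π y : M, TangentSpace I y)) x :=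
  FiberBundle.contMDiffAt_extend ..

theorem inner_curvature_comm (x : M) (u v w t : TangentSpace I x) :
    inner ℝ (curvature I x u v w) t = inner ℝ (curvature I x w t u) v := by
  have h := inner_curvatureField_comm (contMDiffAt_extend_tangent u) (contMDiffAt_extend_tangent v)
    (contMDiffAt_extend_tangent w) (contMDiffAt_extend_tangent t)
  rw [FiberBundle.extend_apply_self, FiberBundle.extend_apply_self] at h
  exact h

theorem IsKilling.inner_nabla_swap {K X Y : Π x : M, TangentSpace I x} (hK : IsKilling I K)
    (x : M) : inner ℝ (nabla X K x) (Y x) = - inner ℝ (nabla Y K x) (X x) := by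
  rw [real_inner_comm (X x)]
  exact hK.2 x (X x) (Y x)

/-- The second covariant derivative of a Killing field is skew in its last two slots. -/
theorem IsKilling.inner_nabla_nabla_swap {K X Y Z : Π x : M, TangentSpace I x} {x : M}
    (hK : IsKilling I K) (hX : CMDiffAt ∞ (T% X) x) (hY : CMDiffAt ∞ (T% Y) x)
    (hZ : CMDiffAt ∞ (T% Z) x) :
    inner ℝ (nabla X (nabla Y K) x - nabla (nabla X Y) K x) (Z x) =
      - inner ℝ (nabla X (nabla Z K) x - nabla (nabla X Z) K x) (Y x) := by
  have md := fun {X : Π x : M, TangentSpace I x} (h : CMDiffAt ∞ (T% X) x) =>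
    h.mdifferentiableAt (by simp)
  have hKx : CMDiffAt ∞ (T% K) x := hK.1 x
  have hYK := contMDiffAt_nabla hY hKx
  have hZK := contMDiffAt_nabla hZ hKx
  have h0 : (fun y => inner ℝ (nabla Y K y) (Z y)) + (fun y => inner ℝ (nabla Z K y) (Y y)) =
      fun _ => (0 : ℝ) := by
    ext y
    simp [hK.inner_nabla_swap (X := Y) (Y := Z)]
  have h1 := congr(d% $h0 x (X x))
  rw [mvfderiv_add (mdifferentiableAt_inner I (md hYK) (md hZ))
    (mdifferentiableAt_inner I (md hZK) (md hY)), add_apply,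
    mvfderiv_inner (md hX) (md hYK) (md hZ), mvfderiv_inner (md hX) (md hZK) (md hY),
    mvfderiv_const] at h1
  rw [inner_sub_left, inner_sub_left, hK.inner_nabla_swap (X := nabla X Y),
    hK.inner_nabla_swap (X := nabla X Z)]
  simp only [zero_apply] at h1
  linarith

/-- Kostant's identity `∇²_{X,Y} K = R(X,K)Y` for a Killing field `K`. -/
theorem IsKilling.inner_nabla_nabla {K X Y Z : Π x : M, TangentSpace I x} {x : M}
    (hK : IsKilling I K) (hX : CMDiffAt ∞ (T% X) x) (hY : CMDiffAt ∞ (T% Y) x)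
    (hZ : CMDiffAt ∞ (T% Z) x) :
    inner ℝ (nabla X (nabla Y K) x - nabla (nabla X Y) K x) (Z x) =
      inner ℝ (curvatureField X K Y x) (Z x) := by
  have hKx : CMDiffAt ∞ (T% K) x := hK.1 x
  -- The skew part of the second covariant derivative in its first two slots is the curvature.
  have skew : ∀ {X Y Z : Π x : M, TangentSpace I x}, CMDiffAt ∞ (T% X) x → CMDiffAt ∞ (T% Y) x →
      inner ℝ (nabla X (nabla Y K) x - nabla (nabla X Y) K x) (Z x) -
        inner ℝ (nabla Y (nabla X K) x - nabla (nabla Y X) K x) (Z x) =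
      inner ℝ (curvatureField X Y K x) (Z x) := by
    intro X Y Z hX hY
    rw [← inner_sub_left]
    congr 1
    have h := nabla_sub_nabla (hX.mdifferentiableAt (by simp)) (hY.mdifferentiableAt (by simp))
    simp only [curvatureField]
    have h' : nabla (mlieBracket I X Y) K x =
        nabla (nabla X Y) K x - nabla (nabla Y X) K x := by
      simp only [nabla] at h ⊢
      rw [← h, map_sub]
    rw [h']
    abel
  have bi := curvatureField_cyclic hX hY hZ
  have b1 := congr(inner ℝ $bi (K x))
  simp only [inner_add_left, inner_zero_left] at b1
  linarith [skew (Z := Z) hX hY, skew (Z := X) hY hZ, skew (Z := Y) hZ hX,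
    hK.inner_nabla_nabla_swap hX hY hZ, hK.inner_nabla_nabla_swap hY hX hZ,
    hK.inner_nabla_nabla_swap hZ hX hY, inner_curvatureField_swap hX hY hKx hZ,
    inner_curvatureField_swap hY hZ hKx hX, inner_curvatureField_swap hZ hX hKx hY,
    inner_curvatureField_comm hX hKx hY hZ, inner_curvatureField_swap hY hZ hX hKx]

/-- For commuting Killing fields `K, K'` the curvature `R(K,K')` is the commutator of `∇K` and
`∇K'`: differentiate `∇_K K' = ∇_K' K` and use Kostant's identity and the Bianchi identity. -/
theorem IsKilling.inner_curvature {K K' : Π x : M, TangentSpace I x} (hK : IsKilling I K)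
    (hK' : IsKilling I K') (hcomm : ∀ x : M, mlieBracket I K K' x = 0) (x : M)
    (w t : TangentSpace I x) :
    inner ℝ (curvature I x (K x) (K' x) w) t =
      inner ℝ (leviCivita I M K x (leviCivita I M K' x w)) t -
        inner ℝ (leviCivita I M K' x (leviCivita I M K x w)) t := by
  have hKx : CMDiffAt ∞ (T% K) x := hK.1 x
  have hKx' : CMDiffAt ∞ (T% K') x := hK'.1 x
  set W : Π y : M, TangentSpace I y := FiberBundle.extend E w with hWdef
  set T : Π y : M, TangentSpace I y := FiberBundle.extend E t with hTdef
  have hW : CMDiffAt ∞ (T% W) x := contMDiffAt_extend_tangent w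
  have hT : CMDiffAt ∞ (T% T) x := contMDiffAt_extend_tangent t
  have hw : W x = w := FiberBundle.extend_apply_self ..
  have ht : T x = t := FiberBundle.extend_apply_self ..
  rw [← hw, ← ht, curvature_apply hKx hKx' hW]
  have h0 : nabla K K' = nabla K' K := by
    ext y
    rw [← sub_eq_zero, nabla_sub_nabla ((hK.1 y).mdifferentiableAt (by simp))
      ((hK'.1 y).mdifferentiableAt (by simp)), hcomm]
  have h1 := hK.inner_nabla_nabla hW hKx' hT
  have h2 := hK'.inner_nabla_nabla hW hKx hT
  rw [h0] at h2
  rw [inner_sub_left] at h1 h2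
  have bi := congr(inner ℝ $(curvatureField_cyclic hKx hKx' hW) (T x))
  simp only [inner_add_left, inner_zero_left] at bi
  rw [curvatureField_swap K' W K, inner_neg_left] at bi
  change _ = inner ℝ (nabla (nabla W K') K x) (T x) - inner ℝ (nabla (nabla W K) K' x) (T x)
  linarith

end Killing

/-! ### The Hodge star of a Euclidean four-space -/

section FourSpace

variable {V : Type*} [NormedAddCommGroup V] [InnerProductSpace ℝ V]

/-- The product of two values of the volume form is the determinant of the mixed Gram matrix. -/
theorem volumeForm_mul_volumeForm {n : ℕ} [Fact (finrank ℝ V = n + 1)]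
    (o : Orientation ℝ V (Fin (n + 1))) (x y : Fin (n + 1) → V) :
    o.volumeForm x * o.volumeForm y = (Matrix.of fun i j => inner ℝ (x i) (y j)).det := by
  have : FiniteDimensional ℝ V := .of_fact_finrank_eq_succ n
  let e := o.finOrthonormalBasis n.succ_pos Fact.out
  have he : e.toBasis.orientation = o := o.finOrthonormalBasis_orientation n.succ_pos Fact.out
  rw [o.volumeForm_robust e he, Basis.det_apply, Basis.det_apply,
    ← Matrix.det_transpose (e.toBasis.toMatrix x), ← Matrix.det_mul]
  congr 1
  ext i j
  rw [Matrix.of_apply, ← e.sum_inner_mul_inner (x i) (y j)]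
  simp [Matrix.mul_apply, Basis.toMatrix_apply, OrthonormalBasis.repr_apply_apply,
    real_inner_comm (x i)]

variable [FiniteDimensional ℝ V] [Fact (finrank ℝ V = 4)]

variable (V) in
/-- The standard orthonormal basis of a Euclidean four-space, indexed by `Fin 4`. -/
def fourBasis : OrthonormalBasis (Fin 4) ℝ V :=
  (stdOrthonormalBasis ℝ V).reindex (finCongr (Fact.out : finrank ℝ V = 4))

theorem hodgeStar_eq_sum (o : Orientation ℝ V (Fin 4)) (α : V → V → ℝ) (u v : V) :
    hodgeStar o α u v = (1 / 2 : ℝ) * ∑ i, ∑ j, α (fourBasis V i) (fourBasis V j) *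
      o.volumeForm ![fourBasis V i, fourBasis V j, u, v] := by
  simp only [hodgeStar, fourBasis, OrthonormalBasis.reindex_apply]
  congr 1
  rw [← Equiv.sum_comp (finCongr (Fact.out : finrank ℝ V = 4)).symm]
  refine Finset.sum_congr rfl fun i _ => ?_
  rw [← Equiv.sum_comp (finCongr (Fact.out : finrank ℝ V = 4)).symm]

theorem inner_apply_eq_sum (A : V →L[ℝ] V) (u v : V) :
    inner ℝ (A u) v = ∑ i, ∑ j, inner ℝ (fourBasis V i) u * inner ℝ (fourBasis V j) v *
      inner ℝ (A (fourBasis V i)) (fourBasis V j) := by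
  conv_lhs => rw [← (fourBasis V).sum_repr' u, ← (fourBasis V).sum_repr' v]
  simp only [map_sum, sum_inner, inner_sum, map_smul, real_inner_smul_left, real_inner_smul_right]
  rw [Finset.sum_comm]
  exact Finset.sum_congr rfl fun i _ => Finset.sum_congr rfl fun j _ => by ring

/-- If `*α` vanishes on `k, l`, then `α` vanishes on the orthogonal complement of `k, l`. -/
theorem inner_apply_eq_zero_of_hodgeStar_eq_zero (o : Orientation ℝ V (Fin 4)) (A : V →L[ℝ] V)
    (hA : ∀ u v, inner ℝ (A u) v = - inner ℝ u (A v)) {k l u v : V}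
    (h : hodgeStar o (fun u v => inner ℝ (A u) v) k l = 0)
    (hkl : inner ℝ k k * inner ℝ l l - inner ℝ k l * inner ℝ k l ≠ 0)
    (huk : inner ℝ u k = 0) (hul : inner ℝ u l = 0) (hvk : inner ℝ v k = 0)
    (hvl : inner ℝ v l = 0) : inner ℝ (A u) v = 0 := by
  -- The mixed Gram determinant splits into two blocks, because `u, v` are orthogonal to `k, l`.
  have key : ∀ i j, o.volumeForm ![fourBasis V i, fourBasis V j, k, l] *
      o.volumeForm ![u, v, k, l] =
      (inner ℝ (fourBasis V i) u * inner ℝ (fourBasis V j) v -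
        inner ℝ (fourBasis V j) u * inner ℝ (fourBasis V i) v) *
        (inner ℝ k k * inner ℝ l l - inner ℝ k l * inner ℝ k l) := by
    intro i j
    rw [volumeForm_mul_volumeForm]
    rw [real_inner_comm] at huk hul hvk hvl
    simp [Matrix.det_succ_row_zero, Fin.sum_univ_succ, Fin.succAbove, huk, hul, hvk, hvl,
      real_inner_comm k l]
    ring
  have h1 : hodgeStar o (fun u v => inner ℝ (A u) v) k l * o.volumeForm ![u, v, k, l] =
      inner ℝ (A u) v * (inner ℝ k k * inner ℝ l l - inner ℝ k l * inner ℝ k l) := by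
    have h2 : ∑ i, ∑ j, inner ℝ (fourBasis V j) u * inner ℝ (fourBasis V i) v *
        inner ℝ (A (fourBasis V i)) (fourBasis V j) = - inner ℝ (A u) v := by
      rw [hA, neg_neg, real_inner_comm, inner_apply_eq_sum]
      exact Finset.sum_congr rfl fun i _ => Finset.sum_congr rfl fun j _ => by
        rw [mul_comm (inner ℝ _ u)]
    have h3 := inner_apply_eq_sum A u v
    have h4 : inner ℝ (A u) v = (1 / 2 : ℝ) * (inner ℝ (A u) v - - inner ℝ (A u) v) := by ring
    rw [h4, ← h2, h3, hodgeStar_eq_sum]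
    simp only [Finset.mul_sum, Finset.sum_mul, ← Finset.sum_sub_distrib]
    refine Finset.sum_congr rfl fun i _ => Finset.sum_congr rfl fun j _ => ?_
    linear_combination (1 / 2 : ℝ) * inner ℝ (A (fourBasis V i)) (fourBasis V j) * key i j
  rw [h, zero_mul] at h1
  exact (mul_eq_zero.1 h1.symm).resolve_right hkl

/-- The Hodge star in coordinates; the sign `ε` compares `o` with the orientation of the basis. -/
theorem exists_hodgeStar_eq (o : Orientation ℝ V (Fin 4)) :
    ∃ ε : ℝ, (ε = 1 ∨ ε = -1) ∧ ∀ (α : V → V → ℝ), (∀ u v, α u v = - α v u) → ∀ u v : V,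
      let e := fourBasis V
      let p : Fin 4 → Fin 4 → ℝ := fun i j =>
        inner ℝ (e i) u * inner ℝ (e j) v - inner ℝ (e j) u * inner ℝ (e i) v
      hodgeStar o α u v = ε * (α (e 0) (e 1) * p 2 3 - α (e 0) (e 2) * p 1 3 +
        α (e 0) (e 3) * p 1 2 + α (e 1) (e 2) * p 0 3 - α (e 1) (e 3) * p 0 2 +
        α (e 2) (e 3) * p 0 1) := by
  have hvol : ∃ ε : ℝ, (ε = 1 ∨ ε = -1) ∧ ∀ x, o.volumeForm x =
      ε * (fourBasis V).toBasis.det x := by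
    by_cases he : (fourBasis V).toBasis.orientation = o
    · exact ⟨1, .inl rfl, fun x => by rw [o.volumeForm_robust _ he, one_mul]⟩
    · exact ⟨-1, .inr rfl, fun x => by
        rw [o.volumeForm_robust_neg _ he, AlternatingMap.neg_apply, neg_one_mul]⟩
  obtain ⟨ε, hε, hvol⟩ := hvol
  refine ⟨ε, hε, fun α hα u v => ?_⟩
  have h0 : ∀ i, α (fourBasis V i) (fourBasis V i) = 0 := fun i => by
    linarith [hα (fourBasis V i) (fourBasis V i)]
  rw [hodgeStar_eq_sum]
  simp only [hvol, Basis.det_apply, Fin.sum_univ_four, h0,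
    hα (fourBasis V 1) (fourBasis V 0), hα (fourBasis V 2) (fourBasis V 0),
    hα (fourBasis V 3) (fourBasis V 0), hα (fourBasis V 2) (fourBasis V 1),
    hα (fourBasis V 3) (fourBasis V 1), hα (fourBasis V 3) (fourBasis V 2)]
  have hd : ∀ a b : Fin 4, ((fourBasis V).toBasis.toMatrix ![fourBasis V a, fourBasis V b, u, v]) =
      Matrix.of fun i j => ![if i = a then 1 else 0, if i = b then 1 else 0,
        inner ℝ (fourBasis V i) u, inner ℝ (fourBasis V i) v] j := by
    intro a b
    ext i j
    fin_cases j <;> simp [Basis.toMatrix_apply, OrthonormalBasis.repr_apply_apply]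
  simp only [hd]
  simp [Matrix.det_succ_row_zero, Fin.sum_univ_succ, Fin.succAbove]
  ring

/-- Let `A, B` be skew with `A l = B k`, and suppose that the two-form
`⟨[A,B] w, t⟩ - (c / 3) (⟨k,t⟩⟨l,w⟩ - ⟨k,w⟩⟨l,t⟩)` is selfdual, where `c ≠ 0`. The antiselfdual
part of `[A,B]` is the vector product of the antiselfdual parts of `A` and `B`, so it is orthogonal
to both of them; hence the antiselfdual parts of `A` and `B` vanish on `k, l`. Since `A` and `B`
vanish on `k, l` as well, so do `*A` and `*B`. -/
theorem hodgeStar_eq_zero_of_selfdual_commutator (o : Orientation ℝ V (Fin 4)) {A B : V →L[ℝ] V}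
    (hA : ∀ u v, inner ℝ (A u) v = - inner ℝ u (A v))
    (hB : ∀ u v, inner ℝ (B u) v = - inner ℝ u (B v)) {k l : V} (hAB : A l = B k)
    {c : ℝ} (hc : c ≠ 0) {W : V → V → ℝ}
    (hW : ∀ w t, W w t = inner ℝ (A (B w)) t - inner ℝ (B (A w)) t -
      c / 3 * (inner ℝ k t * inner ℝ l w - inner ℝ k w * inner ℝ l t))
    (hsd : ∀ w t, hodgeStar o W w t = W w t) :
    hodgeStar o (fun u v => inner ℝ (A u) v) k l = 0 ∧
      hodgeStar o (fun u v => inner ℝ (B u) v) k l = 0 := by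
  obtain ⟨ε, hε, hstar⟩ := exists_hodgeStar_eq o
  have hA' : ∀ u v, inner ℝ (A u) v = - inner ℝ (A v) u := fun u v => by
    rw [hA, real_inner_comm]
  have hB' : ∀ u v, inner ℝ (B u) v = - inner ℝ (B v) u := fun u v => by
    rw [hB, real_inner_comm]
  have hcomm : ∀ u v, inner ℝ (A (B u)) v = inner ℝ (B (A v)) u := fun u v => by
    rw [hA, hB, neg_neg, real_inner_comm]
  have hW' : ∀ u v, W u v = - W v u := fun u v => by
    rw [hW, hW, hcomm u v, hcomm v u]
    ring
  have hAkl : inner ℝ (A k) l = 0 := by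
    rw [hA, hAB]
    linarith [hB k k, real_inner_comm k (B k)]
  have hBkl : inner ℝ (B k) l = 0 := by
    rw [← hAB]
    linarith [hA l l, real_inner_comm l (A l)]
  let e := fourBasis V
  have hWe : ∀ i j, W (e i) (e j) = ∑ m, (inner ℝ (A (e i)) (e m) * inner ℝ (B (e j)) (e m) -
      inner ℝ (B (e i)) (e m) * inner ℝ (A (e j)) (e m)) -
      c / 3 * (inner ℝ (e j) k * inner ℝ (e i) l - inner ℝ (e i) k * inner ℝ (e j) l) := by
    have comp : ∀ {C D : V →L[ℝ] V}, (∀ u v, inner ℝ (C u) v = - inner ℝ u (C v)) → ∀ i j,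
        inner ℝ (C (D (e i))) (e j) = - ∑ m, inner ℝ (D (e i)) (e m) * inner ℝ (C (e j)) (e m) := by
      intro C D hC i j
      rw [hC, ← e.sum_inner_mul_inner]
      simp only [real_inner_comm (C (e j))]
    intro i j
    rw [hW, comp hA, comp hB, Finset.sum_sub_distrib, real_inner_comm (e i) k,
      real_inner_comm (e j) k, real_inner_comm (e i) l, real_inner_comm (e j) l]
    ring
  have e01 := hsd (e 0) (e 1)
  have e02 := hsd (e 0) (e 2)
  have e03 := hsd (e 0) (e 3)
  rw [hstar W hW'] at e01 e02 e03
  rw [hstar _ hA', hstar _ hB']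
  rw [inner_apply_eq_sum] at hAkl hBkl
  have diag : ∀ {C : V →L[ℝ] V}, (∀ u v, inner ℝ (C u) v = - inner ℝ (C v) u) →
      ∀ i, inner ℝ (C (e i)) (e i) = 0 := fun h i => by linarith [h (e i) (e i)]
  have dA := diag hA'
  have dB := diag hB'
  change ε * (W (e 0) (e 1) * _ - W (e 0) (e 2) * _ + W (e 0) (e 3) * _ + W (e 1) (e 2) * _ -
    W (e 1) (e 3) * _ + W (e 2) (e 3) * _) = _ at e01 e02 e03
  simp only [hWe] at e01 e02 e03
  simp only [e, OrthonormalBasis.inner_eq_ite, Fin.sum_univ_four, Fin.reduceEq, if_true, if_false,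
    mul_zero, mul_one, sub_zero, zero_sub, add_zero, zero_add]
    at e01 e02 e03 hAkl hBkl dA dB ⊢
  simp only [dA, dB, hA' (fourBasis V 1) (fourBasis V 0), hA' (fourBasis V 2) (fourBasis V 0),
    hA' (fourBasis V 3) (fourBasis V 0), hA' (fourBasis V 2) (fourBasis V 1),
    hA' (fourBasis V 3) (fourBasis V 1), hA' (fourBasis V 3) (fourBasis V 2),
    hB' (fourBasis V 1) (fourBasis V 0), hB' (fourBasis V 2) (fourBasis V 0),
    hB' (fourBasis V 3) (fourBasis V 0), hB' (fourBasis V 2) (fourBasis V 1),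
    hB' (fourBasis V 3) (fourBasis V 1), hB' (fourBasis V 3) (fourBasis V 2)]
    at e01 e02 e03 hAkl hBkl ⊢
  generalize inner ℝ (A (fourBasis V 0)) (fourBasis V 1) = A01 at *
  generalize inner ℝ (A (fourBasis V 0)) (fourBasis V 2) = A02 at *
  generalize inner ℝ (A (fourBasis V 0)) (fourBasis V 3) = A03 at *
  generalize inner ℝ (A (fourBasis V 1)) (fourBasis V 2) = A12 at *
  generalize inner ℝ (A (fourBasis V 1)) (fourBasis V 3) = A13 at *
  generalize inner ℝ (A (fourBasis V 2)) (fourBasis V 3) = A23 at *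
  generalize inner ℝ (B (fourBasis V 0)) (fourBasis V 1) = B01 at *
  generalize inner ℝ (B (fourBasis V 0)) (fourBasis V 2) = B02 at *
  generalize inner ℝ (B (fourBasis V 0)) (fourBasis V 3) = B03 at *
  generalize inner ℝ (B (fourBasis V 1)) (fourBasis V 2) = B12 at *
  generalize inner ℝ (B (fourBasis V 1)) (fourBasis V 3) = B13 at *
  generalize inner ℝ (B (fourBasis V 2)) (fourBasis V 3) = B23 at *
  clear hsd hW' hcomm hWe hstar hA' hB' diag dA dB hW hA hB
  have hc3 : c / 3 ≠ 0 := div_ne_zero hc (by norm_num)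
  -- The three selfduality equations `e01, e02, e03` say that the antiselfdual part of `[A,B]` is a
  -- multiple of that of `k ∧ l`. Pairing them with the antiselfdual part of `A` (or `B`), whose
  -- coordinates are `A01 ∓ A23`, `A02 ± A13`, `A03 ∓ A12`, removes the commutator.
  constructor <;> refine mul_left_cancel₀ hc3 ?_
  · rcases hε with rfl | rfl
    · linear_combination (A01 - A23) * e01 + (A02 + A13) * e02 + (A03 - A12) * e03 + c / 3 * hAkl
    · linear_combination (A01 + A23) * e01 + (A02 - A13) * e02 + (A03 + A12) * e03 + c / 3 * hAkl
  · rcases hε with rfl | rfl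
    · linear_combination (B01 - B23) * e01 + (B02 + B13) * e02 + (B03 - B12) * e03 + c / 3 * hBkl
    · linear_combination (B01 + B23) * e01 + (B02 - B13) * e02 + (B03 + B12) * e03 + c / 3 * hBkl

end FourSpace

/-! ### Vanishing of the twist scalars -/

section TwistScalars

variable {M : Type*} [TopologicalSpace M] [ChartedSpace (EuclideanSpace ℝ (Fin 4)) M]
  [RiemannianBundle (fun x : M => TangentSpace (𝓡 4) x)] [IsManifold (𝓡 4) ∞ M]
  [IsContMDiffRiemannianBundle (𝓡 4) ∞ (EuclideanSpace ℝ (Fin 4))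
    (fun x : M => TangentSpace (𝓡 4) x)]

theorem scal_eq_of_ricci_eq {x : M} {c : ℝ}
    (hc : ∀ v w : TangentSpace (𝓡 4) x, ricci (𝓡 4) x v w = c * inner ℝ v w) :
    scal (𝓡 4) x = 4 * c := by
  have h : finrank ℝ (TangentSpace (𝓡 4) x) = 4 := finrank_tangentSpace x
  simp only [scal, hc, real_inner_self_eq_norm_sq, OrthonormalBasis.norm_eq_one]
  simp [h]

/-- Both twist scalars vanish: selfduality and the Einstein condition determine the antiselfdual
part of the two-form `R(·,·,K,K')`, which is also the commutator of `∇K` and `∇K'`. -/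
theorem twistScalar_eq_zero {o : Π x : M, Orientation ℝ (TangentSpace (𝓡 4) x) (Fin 4)}
    (hsd : IsSelfdual o) (hE : IsEinstein (𝓡 4) M) (hs : ∀ x : M, scal (𝓡 4) x ≠ 0)
    {K K' : Π x : M, TangentSpace (𝓡 4) x} (hK : IsKilling (𝓡 4) K) (hK' : IsKilling (𝓡 4) K')
    (hcomm : ∀ x : M, mlieBracket (𝓡 4) K K' x = 0) (x : M) :
    twistScalar o K K' K x = 0 ∧ twistScalar o K K' K' x = 0 := by
  obtain ⟨c, hc⟩ := hE
  have hscal : scal (𝓡 4) x = 4 * c := scal_eq_of_ricci_eq (hc x)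
  have hc0 : c ≠ 0 := by
    rintro rfl
    exact hs x (by rw [hscal, mul_zero])
  have hAB : leviCivita (𝓡 4) M K x (K' x) = leviCivita (𝓡 4) M K' x (K x) := by
    have h := nabla_sub_nabla ((hK'.1 x).mdifferentiableAt (by simp))
      ((hK.1 x).mdifferentiableAt (by simp))
    rw [mlieBracket_swap_apply, hcomm, neg_zero, sub_eq_zero] at h
    exact h
  refine hodgeStar_eq_zero_of_selfdual_commutator (o x) (hK.2 x) (hK'.2 x) hAB hc0
    (W := fun w t => weyl x w t (K x) (K' x)) (fun w t => ?_) (fun w t => hsd x w t (K x) (K' x))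
  -- For `Ric = c g` the curvature is `W` plus `c / 3` times that of the unit sphere.
  simp only [weyl, hc, hscal, inner_curvature_comm x w t, hK.inner_curvature hK' hcomm]
  simp only [real_inner_comm w, real_inner_comm t]
  ring

end TwistScalars

/-! ### The forms dual to a pair of vectors -/

section DualForm

variable {V : Type*} [NormedAddCommGroup V] [InnerProductSpace ℝ V]

/-- The Gram determinant of two vectors. -/
def gramDet (k l : V) : ℝ := inner ℝ k k * inner ℝ l l - inner ℝ k l * inner ℝ k l

theorem gramDet_comm (k l : V) : gramDet k l = gramDet l k := by
  simp only [gramDet, real_inner_comm k l]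
  ring

theorem gramDet_pos_iff {k l : V} : 0 < gramDet k l ↔ LinearIndependent ℝ ![k, l] := by
  have h : gramDet k l = (Matrix.gram ℝ ![k, l]).det := by
    simp [gramDet, Matrix.det_fin_two, real_inner_comm k l, Matrix.gram_apply]
  rw [h]
  refine ⟨fun h => Matrix.linearIndependent_of_det_gram_ne_zero h.ne',
    fun h => (Matrix.posDef_gram_of_linearIndependent h).det_pos⟩

/-- The linear form that takes the value `1` on `k` and `0` on `l` and on the orthogonal complement
of `k, l`, for linearly independent `k, l`. -/
def dualForm (k l : V) : V →L[ℝ] ℝ :=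
  (gramDet k l)⁻¹ • (inner ℝ l l • innerSL ℝ k - inner ℝ k l • innerSL ℝ l)

theorem dualForm_apply (k l v : V) : dualForm k l v =
    (inner ℝ l l * inner ℝ k v - inner ℝ k l * inner ℝ l v) / gramDet k l := by
  simp [dualForm, div_eq_inv_mul]

theorem inner_eq_dualForm {k l : V} (h : gramDet k l ≠ 0) (v : V) :
    inner ℝ k v = inner ℝ k k * dualForm k l v + inner ℝ k l * dualForm l k v := by
  rw [dualForm_apply, dualForm_apply, gramDet_comm l k, ← mul_div_assoc, ← mul_div_assoc,
    ← add_div, eq_div_iff h, gramDet, real_inner_comm k l]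
  ring

theorem dualForm_self {k l : V} (h : gramDet k l ≠ 0) : dualForm k l k = 1 := by
  rw [dualForm_apply, div_eq_one_iff_eq h, gramDet, real_inner_comm k l]
  ring

theorem dualForm_other (k l : V) : dualForm k l l = 0 := by
  rw [dualForm_apply, mul_comm, sub_self, zero_div]

/-- If a skew `A` vanishes on `k, l` and on the orthogonal complement of `k, l`, it is a sum of
exterior products with the dual forms of `k, l`. -/
theorem inner_apply_eq_wedge {k l : V} (h : gramDet k l ≠ 0) {A : V →L[ℝ] V}
    (hA : ∀ u v, inner ℝ (A u) v = - inner ℝ u (A v)) (hkl : inner ℝ (A k) l = 0)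
    (horth : ∀ u v, inner ℝ u k = 0 → inner ℝ u l = 0 → inner ℝ v k = 0 → inner ℝ v l = 0 →
      inner ℝ (A u) v = 0) (u v : V) :
    inner ℝ (A u) v = inner ℝ (A u) k * dualForm k l v - inner ℝ (A v) k * dualForm k l u +
      (inner ℝ (A u) l * dualForm l k v - inner ℝ (A v) l * dualForm l k u) := by
  have hA' : ∀ u v, inner ℝ (A u) v = - inner ℝ (A v) u := fun u v => by
    rw [hA, real_inner_comm]
  have h' : gramDet l k ≠ 0 := by rwa [gramDet_comm]
  have hk : ∀ w, inner ℝ (w - dualForm k l w • k - dualForm l k w • l) k = 0 := fun w => by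
    simp only [inner_sub_left, real_inner_smul_left, real_inner_comm k w, real_inner_comm k l]
    linarith [inner_eq_dualForm h w]
  have hl : ∀ w, inner ℝ (w - dualForm k l w • k - dualForm l k w • l) l = 0 := fun w => by
    simp only [inner_sub_left, real_inner_smul_left, real_inner_comm l w, real_inner_comm l k]
    linarith [inner_eq_dualForm h' w]
  have key := horth _ _ (hk u) (hl u) (hk v) (hl v)
  have hkk : inner ℝ (A k) k = 0 := by linarith [hA' k k]
  have hll : inner ℝ (A l) l = 0 := by linarith [hA' l l]
  simp only [map_sub, map_smul, inner_sub_left, inner_sub_right, real_inner_smul_left,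
    real_inner_smul_right, hkl, hkk, hll, hA' l k, hA' k v, hA' l v] at key
  linarith

end DualForm

/-! ### Closedness of the dual forms -/

section ClosedForms

variable {E : Type*} [NormedAddCommGroup E] [NormedSpace ℝ E]
  {H : Type*} [TopologicalSpace H] {I : ModelWithCorners ℝ E H}
  {M : Type*} [TopologicalSpace M] [ChartedSpace H M] [IsManifold I ∞ M]
  [FiniteDimensional ℝ E] [RiemannianBundle (fun x : M => TangentSpace I x)]
  [IsContMDiffRiemannianBundle I ∞ E (fun x : M => TangentSpace I x)]

theorem contMDiffAt_gramDet {K K' : Π x : M, TangentSpace I x} {x : M}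
    (hK : CMDiffAt ∞ (T% K) x) (hK' : CMDiffAt ∞ (T% K') x) :
    CMDiffAt ∞ (fun y => gramDet (K y) (K' y)) x :=
  ((contMDiffAt_inner hK hK).mul (contMDiffAt_inner hK' hK')).sub
    ((contMDiffAt_inner hK hK').mul (contMDiffAt_inner hK hK'))

theorem contMDiffAt_dualForm {K K' Y : Π x : M, TangentSpace I x} {x : M}
    (hK : CMDiffAt ∞ (T% K) x) (hK' : CMDiffAt ∞ (T% K') x) (hY : CMDiffAt ∞ (T% Y) x)
    (h0 : gramDet (K x) (K' x) ≠ 0) :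
    CMDiffAt ∞ (fun y => dualForm (K y) (K' y) (Y y)) x := by
  simp only [dualForm_apply]
  exact (((contMDiffAt_inner hK' hK').mul (contMDiffAt_inner hK hY)).sub
    ((contMDiffAt_inner hK hK').mul (contMDiffAt_inner hK' hY))).div₀
      (contMDiffAt_gramDet hK hK') h0

/-- Let `θ, θ'` be the forms dual to two commuting Killing fields `K, K'`, and suppose that `∇K`
vanishes on the orthogonal complement of `K, K'`. The exterior derivative of the identity
`⟨K,·⟩ = ⟨K,K⟩ θ + ⟨K,K'⟩ θ'` shows that `⟨K,K⟩ dθ + ⟨K,K'⟩ dθ' = 0`. -/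
theorem IsKilling.mvfderiv_dualForm {K K' X Y : Π x : M, TangentSpace I x} {x : M}
    (hK : IsKilling I K) (hK' : IsKilling I K') (hcomm : mlieBracket I K K' x = 0)
    (h0 : gramDet (K x) (K' x) ≠ 0)
    (horth : ∀ u v, inner ℝ u (K x) = 0 → inner ℝ u (K' x) = 0 → inner ℝ v (K x) = 0 →
      inner ℝ v (K' x) = 0 → inner ℝ (leviCivita I M K x u) v = 0)
    (hX : CMDiffAt ∞ (T% X) x) (hY : CMDiffAt ∞ (T% Y) x) (hXY : mlieBracket I X Y x = 0) :
    inner ℝ (K x) (K x) * (d% (fun y => dualForm (K y) (K' y) (Y y)) x (X x) -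
        d% (fun y => dualForm (K y) (K' y) (X y)) x (Y x)) +
      inner ℝ (K x) (K' x) * (d% (fun y => dualForm (K' y) (K y) (Y y)) x (X x) -
        d% (fun y => dualForm (K' y) (K y) (X y)) x (Y x)) = 0 := by
  have md := fun {X : Π x : M, TangentSpace I x} (h : CMDiffAt ∞ (T% X) x) =>
    h.mdifferentiableAt (by simp)
  have hKx : CMDiffAt ∞ (T% K) x := hK.1 x
  have hKx' : CMDiffAt ∞ (T% K') x := hK'.1 x
  have h0' : gramDet (K' x) (K x) ≠ 0 := by rwa [gramDet_comm]
  have hAB : leviCivita I M K x (K' x) = leviCivita I M K' x (K x) := by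
    have h := nabla_sub_nabla (md hKx) (md hKx')
    rw [hcomm, sub_eq_zero] at h
    exact h.symm
  have hKK' : inner ℝ (leviCivita I M K x (K x)) (K' x) = 0 := by
    rw [hK.2 x, hAB, ← hK'.2 x]
    linarith [hK'.2 x (K x) (K x), real_inner_comm (K x) (leviCivita I M K' x (K x)),
      hK'.2 x (K x) (K x)]
  have expand : ∀ {X Y : Π x : M, TangentSpace I x}, CMDiffAt ∞ (T% X) x → CMDiffAt ∞ (T% Y) x →
      inner ℝ (nabla X K x) (Y x) + inner ℝ (K x) (nabla X Y x) =
        2 * inner ℝ (nabla X K x) (K x) * dualForm (K x) (K' x) (Y x) +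
        inner ℝ (K x) (K x) * d% (fun y => dualForm (K y) (K' y) (Y y)) x (X x) +
        (2 * inner ℝ (nabla X K x) (K' x) * dualForm (K' x) (K x) (Y x) +
        inner ℝ (K x) (K' x) * d% (fun y => dualForm (K' y) (K y) (Y y)) x (X x)) := by
    intro X Y hX hY
    have e : (fun y => inner ℝ (K y) (Y y)) =ᶠ[𝓝 x]
        (fun y => inner ℝ (K y) (K y)) * (fun y => dualForm (K y) (K' y) (Y y)) +
        (fun y => inner ℝ (K y) (K' y)) * (fun y => dualForm (K' y) (K y) (Y y)) := by
      filter_upwards [(contMDiffAt_gramDet hKx hKx').continuousAt.eventually_ne h0] with y hy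
      exact inner_eq_dualForm hy _
    have m1 := (contMDiffAt_inner hKx hKx).mdifferentiableAt (n := ∞) (by simp)
    have m2 := (contMDiffAt_inner hKx hKx').mdifferentiableAt (n := ∞) (by simp)
    have m3 := (contMDiffAt_dualForm hKx hKx' hY h0).mdifferentiableAt (n := ∞) (by simp)
    have m4 := (contMDiffAt_dualForm hKx' hKx hY h0').mdifferentiableAt (n := ∞) (by simp)
    have h := mvfderiv_congr e (X x)
    rw [mvfderiv_inner (md hX) (md hKx) (md hY), mvfderiv_add (m1.mul m3) (m2.mul m4),
      mvfderiv_mul m1 m3, mvfderiv_mul m2 m4] at h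
    simp only [add_apply, smul_apply, smul_eq_mul,
      mvfderiv_inner (md hX) (md hKx) (md hKx), mvfderiv_inner (md hX) (md hKx) (md hKx')] at h
    have s1 : inner ℝ (K x) (nabla X K x) = inner ℝ (nabla X K x) (K x) := real_inner_comm _ _
    have s2 : inner ℝ (K x) (nabla X K' x) = inner ℝ (nabla X K x) (K' x) := by
      rw [real_inner_comm, hK'.inner_nabla_swap, hK.inner_nabla_swap (Y := K')]
      simp only [nabla, hAB]
    rw [s1, s2] at h
    linarith
  have t := nabla_sub_nabla (md hX) (md hY)
  rw [hXY] at t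
  have t' := congr(inner ℝ (K x) $t)
  rw [inner_sub_right, inner_zero_right] at t'
  have w := inner_apply_eq_wedge h0 (hK.2 x) hKK' horth (X x) (Y x)
  change inner ℝ (nabla X K x) (Y x) = inner ℝ (nabla X K x) (K x) * _ -
    inner ℝ (nabla Y K x) (K x) * _ + (inner ℝ (nabla X K x) (K' x) * _ -
    inner ℝ (nabla Y K x) (K' x) * _) at w
  linarith [expand hX hY, expand hY hX, hK.inner_nabla_swap (X := X) (Y := Y) x]

/-- The form dual to `K` in a pair `K, K'` of commuting Killing fields is closed, if `∇K` and `∇K'`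
vanish on the orthogonal complement of `K, K'`. -/
theorem IsKilling.mvfderiv_dualForm_comm {K K' X Y : Π x : M, TangentSpace I x} {x : M}
    (hK : IsKilling I K) (hK' : IsKilling I K') (hcomm : mlieBracket I K K' x = 0)
    (h0 : gramDet (K x) (K' x) ≠ 0)
    (horth : ∀ u v, inner ℝ u (K x) = 0 → inner ℝ u (K' x) = 0 → inner ℝ v (K x) = 0 →
      inner ℝ v (K' x) = 0 →
      inner ℝ (leviCivita I M K x u) v = 0 ∧ inner ℝ (leviCivita I M K' x u) v = 0)
    (hX : CMDiffAt ∞ (T% X) x) (hY : CMDiffAt ∞ (T% Y) x) (hXY : mlieBracket I X Y x = 0) :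
    d% (fun y => dualForm (K y) (K' y) (Y y)) x (X x) =
      d% (fun y => dualForm (K y) (K' y) (X y)) x (Y x) := by
  have h1 := hK.mvfderiv_dualForm hK' hcomm h0
    (fun u v a b c d => (horth u v a b c d).1) hX hY hXY
  have h2 := hK'.mvfderiv_dualForm hK (by rw [mlieBracket_swap_apply, hcomm, neg_zero])
    (by rwa [gramDet_comm]) (fun u v a b c d => (horth u v b a d c).2) hX hY hXY
  rw [real_inner_comm (K x)] at h2
  refine sub_eq_zero.1 ((mul_eq_zero.1 (?_ : gramDet (K x) (K' x) * _ = 0)).resolve_left h0)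
  unfold gramDet
  linear_combination inner ℝ (K' x) (K' x) * h1 - inner ℝ (K x) (K' x) * h2

end ClosedForms

/-! ### Parametrized level sets -/

section LevelSets

/-- A level set of a smooth map is parametrized by an immersion near a point where the derivative
is surjective. -/
theorem exists_immersion_of_surjective_fderiv {E F : Type*} [NormedAddCommGroup E]
    [NormedSpace ℝ E] [FiniteDimensional ℝ E] [NormedAddCommGroup F] [NormedSpace ℝ F]
    [FiniteDimensional ℝ F] {n : ℕ} (hn : finrank ℝ E = finrank ℝ F + n) {h : E → F} {B : Set E}
    (hB : IsOpen B) {p : E} (hp : p ∈ B) (hh : ContDiffOn ℝ ∞ h B)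
    (hsurj : Function.Surjective (fderiv ℝ h p)) :
    ∃ (S : Set (EuclideanSpace ℝ (Fin n))) (ψ : EuclideanSpace ℝ (Fin n) → E),
      IsOpen S ∧ 0 ∈ S ∧ ψ 0 = p ∧ ContDiffOn ℝ ∞ ψ S ∧
      ∀ s ∈ S, ψ s ∈ B ∧ Function.Injective (fderiv ℝ ψ s) ∧
        ∀ v, fderiv ℝ h (ψ s) (fderiv ℝ ψ s v) = 0 := by
  have := FiniteDimensional.complete ℝ E
  let N := (fderiv ℝ h p).ker
  have hN : finrank ℝ N = n := by
    have h1 := LinearMap.finrank_range_add_finrank_ker (fderiv ℝ h p).toLinearMap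
    rw [LinearMap.range_eq_top.2 hsurj, finrank_top, hn] at h1
    exact Nat.add_left_cancel h1
  obtain ⟨r, hr⟩ := N.subtype.exists_leftInverse_of_injective N.ker_subtype
  have hr' : ∀ v : N, r v = v := fun v => LinearMap.congr_fun hr v
  let P : E →L[ℝ] N := LinearMap.toContinuousLinearMap r
  let ℓ : EuclideanSpace ℝ (Fin n) ≃L[ℝ] N := ContinuousLinearEquiv.ofFinrankEq (by simp [hN])
  -- Complete `h` to a local diffeomorphism by a projection to the kernel of its derivative.
  let Φ : E → F × N := fun q => (h q, P (q - p))
  have hΦd : ∀ q ∈ B, HasFDerivAt Φ ((fderiv ℝ h q).prod P) q := fun q hq =>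
    (((hh.contDiffAt (hB.mem_nhds hq)).differentiableAt (by simp)).hasFDerivAt).prodMk
      (P.hasFDerivAt.comp q ((hasFDerivAt_id q).sub_const p))
  have hΦ : ContDiffOn ℝ ∞ Φ B :=
    hh.prodMk (P.contDiff.comp (contDiff_id.sub contDiff_const)).contDiffOn
  have hinj : Function.Injective ((fderiv ℝ h p).prod P) := by
    refine (injective_iff_map_eq_zero _).2 fun v hv => ?_
    have h1 : fderiv ℝ h p v = 0 := congr_arg Prod.fst hv
    have h2 : r v = 0 := congr_arg Prod.snd hv
    have h3 := hr' ⟨v, h1⟩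
    rw [show ((⟨v, h1⟩ : N) : E) = v from rfl, h2] at h3
    exact (congr_arg Subtype.val h3).symm
  let L : E ≃L[ℝ] F × N := (LinearEquiv.ofInjectiveOfFinrankEq
    ((fderiv ℝ h p).prod P).toLinearMap hinj (by simp [hN, hn])).toContinuousLinearEquiv
  have hL : (L : E →L[ℝ] F × N) = (fderiv ℝ h p).prod P := by
    ext v <;> rfl
  have hΦp : HasFDerivAt Φ (L : E →L[ℝ] F × N) p := hL ▸ hΦd p hp
  let e := (hΦ.contDiffAt (hB.mem_nhds hp)).toOpenPartialHomeomorph Φ hΦp (by simp)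
  have he : ∀ q, e q = Φ q := fun q => rfl
  have hpe : p ∈ e.source :=
    (hΦ.contDiffAt (hB.mem_nhds hp)).mem_toOpenPartialHomeomorph_source hΦp (by simp)
  -- The open set where the derivative of the local diffeomorphism is invertible.
  let G : Set E := B ∩ fderiv ℝ Φ ⁻¹'
    Set.range ((↑) : (E ≃L[ℝ] F × N) → E →L[ℝ] F × N)
  have hG : IsOpen G := ContinuousOn.isOpen_inter_preimage
    (hΦ.continuousOn_fderiv_of_isOpen hB (by simp)) hB ContinuousLinearEquiv.isOpen
  let c : EuclideanSpace ℝ (Fin n) → F × N := fun s => (h p, ℓ s)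
  have hc : ContDiff ℝ ∞ c := contDiff_const.prodMk ℓ.contDiff
  have hcd : ∀ s, HasFDerivAt c ((0 : EuclideanSpace ℝ (Fin n) →L[ℝ] F).prod ℓ) s := fun s =>
    (hasFDerivAt_const (h p) s).prodMk ℓ.hasFDerivAt
  have hc0 : c 0 = e p := by simp [he, Φ, c]
  have hS : IsOpen (c ⁻¹' (e.target ∩ e.symm ⁻¹' G)) :=
    (e.isOpen_inter_preimage_symm hG).preimage hc.continuous
  have hψ : ∀ s ∈ c ⁻¹' (e.target ∩ e.symm ⁻¹' G), ContDiffAt ℝ ∞ (fun s => e.symm (c s)) s := by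
    rintro s ⟨hs, hsB, L', hL'⟩
    refine ContDiffAt.comp s ?_ hc.contDiffAt
    exact e.contDiffAt_symm hs (f₀' := L') (hL' ▸ (hΦd _ hsB).differentiableAt.hasFDerivAt)
      (hΦ.contDiffAt (hB.mem_nhds hsB))
  refine ⟨c ⁻¹' (e.target ∩ e.symm ⁻¹' G), fun s => e.symm (c s), hS, ?_, ?_,
    fun s hs => (hψ s hs).contDiffWithinAt, fun s hs => ?_⟩
  · rw [Set.mem_preimage, hc0]
    exact ⟨e.map_source hpe, by
      rw [Set.mem_preimage, e.left_inv hpe]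
      exact ⟨hp, L, hL.trans (hΦd p hp).fderiv.symm⟩⟩
  · simp only [hc0, e.left_inv hpe]
  · have h1 : Φ ∘ (fun s => e.symm (c s)) =ᶠ[𝓝 s] c := by
      filter_upwards [hS.mem_nhds hs] with t ht
      exact e.right_inv ht.1
    have h2 := ((hΦd _ hs.2.1).comp s ((hψ s hs).differentiableAt (by simp)).hasFDerivAt).unique
      ((hcd s).congr_of_eventuallyEq h1)
    have h3 : ∀ v, fderiv ℝ h (e.symm (c s)) (fderiv ℝ (fun s => e.symm (c s)) s v) = 0 ∧
        P (fderiv ℝ (fun s => e.symm (c s)) s v) = ℓ v := fun v =>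
      ⟨congr_arg Prod.fst (DFunLike.congr_fun h2 v),
        congr_arg Prod.snd (DFunLike.congr_fun h2 v)⟩
    refine ⟨hs.2.1, fun v w hvw => ?_, fun v => (h3 v).1⟩
    refine ℓ.injective ?_
    rw [← (h3 v).2, ← (h3 w).2, hvw]

end LevelSets

/-! ### Coordinate vector fields -/

section CoordinateFields

variable {E : Type*} [NormedAddCommGroup E] [NormedSpace ℝ E]
  {H : Type*} [TopologicalSpace H] {I : ModelWithCorners ℝ E H}
  {M : Type*} [TopologicalSpace M] [ChartedSpace H M] [IsManifold I ∞ M]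

/-- The constant vector field on a vector space. -/
def constField (a : E) : Π y : E, TangentSpace 𝓘(ℝ, E) y := fun _ => a

variable (I) in
/-- The coordinate vector field of the chart at `x₀` in the direction of a vector `a` of the model
space. -/
def coordField (x₀ : M) (a : E) : Π x : M, TangentSpace I x :=
  mpullback I 𝓘(ℝ, E) (extChartAt I x₀) (constField a)

theorem contMDiffAt_constField (a p : E) : CMDiffAt ∞ (T% (constField a)) p :=
  contMDiffAt_vectorSpace_iff_contDiffAt.2 contDiffAt_const

theorem mlieBracket_constField (a b p : E) :
    mlieBracket 𝓘(ℝ, E) (constField a) (constField b) p = 0 := by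
  rw [← mlieBracketWithin_univ, mlieBracketWithin_eq_lieBracketWithin]
  change fderivWithin ℝ (fun _ : E => b) Set.univ p a -
    fderivWithin ℝ (fun _ : E => a) Set.univ p b = 0
  simp

theorem contMDiffAt_coordField [CompleteSpace E] {x₀ x : M} (hx : x ∈ (extChartAt I x₀).source)
    (a : E) : CMDiffAt ∞ (T% (coordField I x₀ a)) x :=
  (contMDiffAt_constField a _).mpullback_vectorField_preimage (n := ∞)
    (contMDiffAt_extChartAt' (by simpa using! hx)) (isInvertible_mfderiv_extChartAt hx) (by simp)

theorem mlieBracket_coordField [CompleteSpace E] {x₀ x : M}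
    (hx : x ∈ (extChartAt I x₀).source) (a b : E) :
    mlieBracket I (coordField I x₀ a) (coordField I x₀ b) x = 0 := by
  have := isManifold_minSmoothness I M 2
  have h2 := mpullback_mlieBracket (I := I) (n := ∞)
    ((contMDiffAt_constField a _).mdifferentiableAt (by simp))
    ((contMDiffAt_constField b _).mdifferentiableAt (by simp))
    (contMDiffAt_extChartAt' (by simpa using! hx)) (by simpa using ENat.LEInfty.out)
  unfold coordField
  rw [← h2, mpullback_apply, mlieBracket_constField, map_zero]

end CoordinateFields

section BoundarylessCoordinateFields

variable {E : Type*} [NormedAddCommGroup E] [NormedSpace ℝ E]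
  {H : Type*} [TopologicalSpace H] {I : ModelWithCorners ℝ E H} [I.Boundaryless]
  {M : Type*} [TopologicalSpace M] [ChartedSpace H M] [IsManifold I ∞ M]

theorem contMDiffAt_extChartAt_symm {x₀ : M} {p : E} (hp : p ∈ (extChartAt I x₀).target) :
    ContMDiffAt 𝓘(ℝ, E) I ∞ (extChartAt I x₀).symm p :=
  (contMDiffOn_extChartAt_symm x₀).contMDiffAt ((isOpen_extChartAt_target x₀).mem_nhds hp)

theorem coordField_extChartAt_symm {x₀ : M} {p : E} (hp : p ∈ (extChartAt I x₀).target) (a : E) :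
    coordField I x₀ a ((extChartAt I x₀).symm p) =
      mfderiv 𝓘(ℝ, E) I (extChartAt I x₀).symm p a := by
  have := isManifold_minSmoothness I M 1
  have h1 := mfderiv_extChartAt_comp_mfderivWithin_extChartAt_symm (I := I) hp
  rw [I.range_eq_univ, mfderivWithin_univ] at h1
  have h2 := isInvertible_mfderiv_extChartAt (I := I) ((extChartAt I x₀).map_target hp)
  have h3 := DFunLike.congr_fun h1 a
  rw [coordField, mpullback_apply]
  refine h2.injective ?_
  rw [h2.self_apply_inverse]
  exact h3.symm

theorem fderiv_comp_extChartAt_symm {x₀ : M} {p : E} (hp : p ∈ (extChartAt I x₀).target)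
    {f : M → ℝ} (hf : MDiffAt f ((extChartAt I x₀).symm p)) (a : E) :
    fderiv ℝ (fun q => f ((extChartAt I x₀).symm q)) p a =
      d% f ((extChartAt I x₀).symm p) (coordField I x₀ a ((extChartAt I x₀).symm p)) := by
  have h : mfderiv 𝓘(ℝ, E) 𝓘(ℝ, ℝ) (f ∘ (extChartAt I x₀).symm) p = _ :=
    mfderiv_comp p hf ((contMDiffAt_extChartAt_symm hp).mdifferentiableAt (by simp))
  rw [mfderiv_eq_fderiv] at h
  rw [coordField_extChartAt_symm hp]
  exact DFunLike.congr_fun h a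

end BoundarylessCoordinateFields

/-! ### Potentials of the dual forms -/

section Potentials

variable {E : Type*} [NormedAddCommGroup E] [NormedSpace ℝ E] [FiniteDimensional ℝ E]
  {H : Type*} [TopologicalSpace H] {I : ModelWithCorners ℝ E H} [I.Boundaryless]
  {M : Type*} [TopologicalSpace M] [ChartedSpace H M] [IsManifold I ∞ M]
  [RiemannianBundle (fun x : M => TangentSpace I x)]
  [IsContMDiffRiemannianBundle I ∞ E (fun x : M => TangentSpace I x)]

/-- In a convex part of a chart, the form dual to `K` in a pair `K, K'` of commuting Killing fields
has a potential, if `∇K` and `∇K'` vanish on the orthogonal complement of `K, K'`. -/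
theorem IsKilling.exists_potential {K K' : Π x : M, TangentSpace I x} (hK : IsKilling I K)
    (hK' : IsKilling I K') (hcomm : ∀ x, mlieBracket I K K' x = 0) {x₀ : M} {B : Set E}
    (hBc : Convex ℝ B) (hBo : IsOpen B) (hB : B ⊆ (extChartAt I x₀).target)
    (h0 : ∀ p ∈ B, gramDet (K ((extChartAt I x₀).symm p)) (K' ((extChartAt I x₀).symm p)) ≠ 0)
    (horth : ∀ x, gramDet (K x) (K' x) ≠ 0 → ∀ u v, inner ℝ u (K x) = 0 → inner ℝ u (K' x) = 0 →
      inner ℝ v (K x) = 0 → inner ℝ v (K' x) = 0 →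
      inner ℝ (leviCivita I M K x u) v = 0 ∧ inner ℝ (leviCivita I M K' x u) v = 0) :
    ∃ h : E → ℝ, ContDiffOn ℝ ∞ h B ∧ ∀ p ∈ B, ∀ a, fderiv ℝ h p a =
      dualForm (K ((extChartAt I x₀).symm p)) (K' ((extChartAt I x₀).symm p))
        (mfderiv 𝓘(ℝ, E) I (extChartAt I x₀).symm p a) := by
  have := FiniteDimensional.complete ℝ E
  let θ : E → E →L[ℝ] ℝ := fun p =>
    (dualForm (K ((extChartAt I x₀).symm p)) (K' ((extChartAt I x₀).symm p))).comp
      (mfderiv 𝓘(ℝ, E) I (extChartAt I x₀).symm p)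
  have hsrc : ∀ p ∈ B, (extChartAt I x₀).symm p ∈ (extChartAt I x₀).source := fun p hp =>
    (extChartAt I x₀).map_target (hB hp)
  have hθa : ∀ p ∈ B, ∀ a, θ p a = dualForm (K ((extChartAt I x₀).symm p))
      (K' ((extChartAt I x₀).symm p)) (coordField I x₀ a ((extChartAt I x₀).symm p)) := by
    intro p hp a
    rw [coordField_extChartAt_symm (hB hp)]
    rfl
  have hsm : ∀ p ∈ B, ∀ a, CMDiffAt ∞ (fun y => dualForm (K y) (K' y) (coordField I x₀ a y))
      ((extChartAt I x₀).symm p) := fun p hp a =>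
    contMDiffAt_dualForm (hK.1 _) (hK'.1 _) (contMDiffAt_coordField (hsrc p hp) a) (h0 p hp)
  have hθ : ContDiffOn ℝ ∞ θ B := by
    refine contDiffOn_clm_apply.2 fun a => ContDiffOn.congr (fun p hp => ?_)
      fun p hp => hθa p hp a
    exact (((hsm p hp a).comp p
      (contMDiffAt_extChartAt_symm (hB hp))).contDiffAt).contDiffWithinAt
  have hθd : ∀ p ∈ B, ∀ a b, fderiv ℝ θ p a b = d% (fun y => dualForm (K y) (K' y)
      (coordField I x₀ b y)) ((extChartAt I x₀).symm p)
        (coordField I x₀ a ((extChartAt I x₀).symm p)) := by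
    intro p hp a b
    have hd : DifferentiableAt ℝ θ p :=
      (hθ.contDiffAt (hBo.mem_nhds hp)).differentiableAt (by simp)
    rw [← fderiv_comp_extChartAt_symm (hB hp) ((hsm p hp b).mdifferentiableAt (by simp))]
    have e : (fun q => θ q b) =ᶠ[𝓝 p] fun q => dualForm (K ((extChartAt I x₀).symm q))
      (K' ((extChartAt I x₀).symm q)) (coordField I x₀ b ((extChartAt I x₀).symm q)) := by
      filter_upwards [hBo.mem_nhds hp] with q hq using hθa q hq b
    rw [← e.fderiv_eq, fderiv_clm_apply hd (differentiableAt_const b)]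
    simp
  obtain ⟨h, hh⟩ := hBc.exists_forall_hasFDerivAt_of_fderiv_symmetric hBo
    (hθ.differentiableOn (by simp)) (fun p hp a b => by
      rw [hθd p hp, hθd p hp]
      exact hK.mvfderiv_dualForm_comm hK' (hcomm _) (h0 p hp) (horth _ (h0 p hp))
        (contMDiffAt_coordField (hsrc p hp) a) (contMDiffAt_coordField (hsrc p hp) b)
        (mlieBracket_coordField (hsrc p hp) a b))
  refine ⟨h, (contDiffOn_infty_iff_fderiv_of_isOpen hBo).2
    ⟨fun p hp => (hh p hp).differentiableAt.differentiableWithinAt,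
      hθ.congr fun p hp => (hh p hp).fderiv⟩, fun p hp a => ?_⟩
  rw [(hh p hp).fderiv]
  rfl

end Potentials

/-! ### Integral surfaces -/

section IntegralSurfaces

variable {M : Type*} [TopologicalSpace M] [ChartedSpace (EuclideanSpace ℝ (Fin 4)) M]
  [RiemannianBundle (fun x : M => TangentSpace (𝓡 4) x)]

theorem mem_orthDistribution_iff {K K' : Π x : M, TangentSpace (𝓡 4) x} {x : M}
    {v : TangentSpace (𝓡 4) x} :
    v ∈ orthDistribution K K' x ↔ inner ℝ (K x) v = 0 ∧ inner ℝ (K' x) v = 0 := by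
  rw [orthDistribution, Submodule.mem_orthogonal]
  refine ⟨fun h => ⟨h _ (Submodule.subset_span (by simp)), h _ (Submodule.subset_span (by simp))⟩,
    fun h u hu => ?_⟩
  obtain ⟨a, b, rfl⟩ := Submodule.mem_span_pair.1 hu
  rw [inner_add_left, real_inner_smul_left, real_inner_smul_left, h.1, h.2, mul_zero, mul_zero,
    add_zero]

theorem finrank_orthDistribution {K K' : Π x : M, TangentSpace (𝓡 4) x} {x : M}
    (h : LinearIndependent ℝ ![K x, K' x]) : finrank ℝ (orthDistribution K K' x) = 2 := by
  have h1 := (Submodule.span ℝ {K x, K' x}).finrank_add_finrank_orthogonal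
  have h2 := finrank_span_eq_card h
  rw [Matrix.range_cons, Matrix.range_cons, Matrix.range_empty, Set.union_empty,
    Set.singleton_union, Fintype.card_fin] at h2
  rw [h2, finrank_tangentSpace] at h1
  exact Nat.add_left_cancel h1

variable [IsManifold (𝓡 4) ∞ M]
  [IsContMDiffRiemannianBundle (𝓡 4) ∞ (EuclideanSpace ℝ (Fin 4))
    (fun x : M => TangentSpace (𝓡 4) x)]

/-- The orthogonal complement of two commuting Killing fields `K, K'` is integrable if `∇K` and
`∇K'` vanish on it: the integral surfaces are the common level sets of local potentials of the two
closed forms dual to `K, K'`. -/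
theorem IsKilling.isIntegrableOn_orthDistribution {K K' : Π x : M, TangentSpace (𝓡 4) x}
    (hK : IsKilling (𝓡 4) K) (hK' : IsKilling (𝓡 4) K')
    (hcomm : ∀ x, mlieBracket (𝓡 4) K K' x = 0)
    (horth : ∀ x, gramDet (K x) (K' x) ≠ 0 → ∀ u v, inner ℝ u (K x) = 0 → inner ℝ u (K' x) = 0 →
      inner ℝ v (K x) = 0 → inner ℝ v (K' x) = 0 →
      inner ℝ (leviCivita (𝓡 4) M K x u) v = 0 ∧ inner ℝ (leviCivita (𝓡 4) M K' x u) v = 0) :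
    IsIntegrableOn (orthDistribution K K') {x : M | LinearIndependent ℝ ![K x, K' x]} := by
  intro x₀ hx₀
  have hx₀' : 0 < gramDet (K x₀) (K' x₀) := gramDet_pos_iff.2 hx₀
  let c := (extChartAt (𝓡 4) x₀).symm
  let p₀ := extChartAt (𝓡 4) x₀ x₀
  have hcp₀ : c p₀ = x₀ := extChartAt_to_inv x₀
  have hW : IsOpen {x : M | 0 < gramDet (K x) (K' x)} := isOpen_lt continuous_const
    (continuous_iff_continuousAt.2 fun x => (contMDiffAt_gramDet (hK.1 x) (hK'.1 x)).continuousAt)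
  -- A coordinate ball on which `K, K'` stay linearly independent.
  obtain ⟨ε, hε, hB⟩ := Metric.isOpen_iff.1 ((continuousOn_extChartAt_symm
    (I := 𝓡 4) x₀).isOpen_inter_preimage (isOpen_extChartAt_target x₀) hW) p₀
      ⟨mem_extChartAt_target x₀, by
        change 0 < gramDet (K (c p₀)) (K' (c p₀))
        rwa [hcp₀]⟩
  have hp₀ : p₀ ∈ Metric.ball p₀ ε := Metric.mem_ball_self hε
  have hBt : Metric.ball p₀ ε ⊆ (extChartAt (𝓡 4) x₀).target := fun p hp => (hB hp).1
  have hBg : ∀ p ∈ Metric.ball p₀ ε, 0 < gramDet (K (c p)) (K' (c p)) := fun p hp => (hB hp).2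
  obtain ⟨h, hh, hθ⟩ := hK.exists_potential hK' hcomm (convex_ball p₀ ε) Metric.isOpen_ball hBt
    (fun p hp => (hBg p hp).ne') horth
  obtain ⟨h', hh', hθ'⟩ := hK'.exists_potential hK
    (fun x => by rw [mlieBracket_swap_apply, hcomm, neg_zero])
    (convex_ball p₀ ε) Metric.isOpen_ball hBt
    (fun p hp => by rw [gramDet_comm]; exact (hBg p hp).ne')
    (fun x hx u v a b a' b' => (horth x (by rwa [gramDet_comm]) u v b a b' a').symm)
  have hfd : ∀ p ∈ Metric.ball p₀ ε, ∀ v, fderiv ℝ (fun q => (h q, h' q)) p v =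
      (dualForm (K (c p)) (K' (c p)) (mfderiv (𝓡 4) (𝓡 4) c p v),
        dualForm (K' (c p)) (K (c p)) (mfderiv (𝓡 4) (𝓡 4) c p v)) := by
    intro p hp v
    have hp' := Metric.isOpen_ball.mem_nhds hp
    rw [DifferentiableAt.fderiv_prodMk ((hh.contDiffAt hp').differentiableAt (by simp))
      ((hh'.contDiffAt hp').differentiableAt (by simp))]
    exact Prod.ext (hθ p hp v) (hθ' p hp v)
  have hinv : ∀ p ∈ Metric.ball p₀ ε, (mfderiv (𝓡 4) (𝓡 4) c p).IsInvertible := fun p hp => by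
    have := isManifold_minSmoothness (𝓡 4) M 1
    have := isInvertible_mfderivWithin_extChartAt_symm (hBt hp)
    rwa [(𝓡 4).range_eq_univ, mfderivWithin_univ] at this
  -- The derivative of `(h, h')` maps the coordinate vectors of `K, K'` to the standard basis.
  have hsurj : Function.Surjective (fderiv ℝ (fun q => (h q, h' q)) p₀) := by
    obtain ⟨a, ha⟩ : ∃ a : EuclideanSpace ℝ (Fin 4), mfderiv (𝓡 4) (𝓡 4) c p₀ a = K (c p₀) :=
      (hinv p₀ hp₀).surjective _
    obtain ⟨b, hb⟩ : ∃ b : EuclideanSpace ℝ (Fin 4), mfderiv (𝓡 4) (𝓡 4) c p₀ b = K' (c p₀) :=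
      (hinv p₀ hp₀).surjective _
    rintro ⟨s, t⟩
    have g := (hBg p₀ hp₀).ne'
    have g' : gramDet (K' (c p₀)) (K (c p₀)) ≠ 0 := by rwa [gramDet_comm]
    refine ⟨s • a + t • b, ?_⟩
    rw [map_add, map_smul, map_smul, hfd p₀ hp₀, hfd p₀ hp₀, ha, hb, dualForm_self g,
      dualForm_self g', dualForm_other, dualForm_other]
    simp
  obtain ⟨S, ψ, hS, h0S, hψ0, hψ, hψS⟩ := exists_immersion_of_surjective_fderiv (n := 2)
    (by simp) Metric.isOpen_ball hp₀ (hh.prodMk hh') hsurj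
  have hφ : ∀ s ∈ S, mfderiv (𝓡 2) (𝓡 4) (c ∘ ψ) s =
      (mfderiv (𝓡 4) (𝓡 4) c (ψ s)).comp (mfderiv (𝓡 2) (𝓡 4) ψ s) := fun s hs =>
    mfderiv_comp s ((contMDiffAt_extChartAt_symm (hBt (hψS s hs).1)).mdifferentiableAt (by simp))
      ((hψ.contDiffAt (hS.mem_nhds hs)).contMDiffAt.mdifferentiableAt (n := ∞) (by simp))
  refine ⟨S, c ∘ ψ, hS, h0S, ?_, ?_, fun s hs => ?_⟩
  · rw [Function.comp_apply, hψ0, hcp₀]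
  · exact (contMDiffOn_extChartAt_symm x₀).comp hψ.contMDiffOn fun s hs => hBt (hψS s hs).1
  obtain ⟨hsB, hsi, hs0⟩ := hψS s hs
  have hlin : LinearIndependent ℝ ![K (c (ψ s)), K' (c (ψ s))] := gramDet_pos_iff.1 (hBg _ hsB)
  have hinj : Function.Injective (mfderiv (𝓡 2) (𝓡 4) (c ∘ ψ) s) := by
    rw [hφ s hs, mfderiv_eq_fderiv]
    exact (hinv _ hsB).injective.comp hsi
  refine ⟨hlin, hinj, Submodule.eq_of_le_of_finrank_eq ?_ ?_⟩
  · rintro _ ⟨v, rfl⟩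
    have e := hs0 v
    rw [hfd _ hsB, Prod.mk_eq_zero] at e
    have e1 := e.1
    have e2 := e.2
    have g := (hBg _ hsB).ne'
    have g' : gramDet (K' (c (ψ s))) (K (c (ψ s))) ≠ 0 := by rwa [gramDet_comm]
    rw [hφ s hs, mfderiv_eq_fderiv]
    refine mem_orthDistribution_iff.2 ⟨(inner_eq_dualForm g _).trans ?_,
      (inner_eq_dualForm g' _).trans ?_⟩
    · exact (congr_arg₂ (fun a b => _ * a + _ * b) e1 e2).trans (by simp)
    · exact (congr_arg₂ (fun a b => _ * a + _ * b) e2 e1).trans (by simp)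
  · rw [Function.comp_apply, finrank_orthDistribution hlin]
    exact (LinearMap.finrank_range_of_inj hinj).trans finrank_euclideanSpace_fin

end IntegralSurfaces

end SelfdualEinstein

theorem mainTheorem3 {M : Type*} [TopologicalSpace M]
    [ChartedSpace (EuclideanSpace ℝ (Fin 4)) M] [IsManifold (𝓡 4) ∞ M]
    [RiemannianBundle (fun x : M => TangentSpace (𝓡 4) x)]
    [IsContMDiffRiemannianBundle (𝓡 4) ∞ (EuclideanSpace ℝ (Fin 4))
      (fun x : M => TangentSpace (𝓡 4) x)]
    (o : Π x : M, Orientation ℝ (TangentSpace (𝓡 4) x) (Fin 4))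
    (ho : SelfdualEinstein.IsManifoldOrientation o)
    (hsd : SelfdualEinstein.IsSelfdual o)
    (hE : SelfdualEinstein.IsEinstein (𝓡 4) M)
    (hs : ∀ x : M, SelfdualEinstein.scal (𝓡 4) x ≠ 0)
    (K K' : Π x : M, TangentSpace (𝓡 4) x)
    (hK : SelfdualEinstein.IsKilling (𝓡 4) K)
    (hK' : SelfdualEinstein.IsKilling (𝓡 4) K')
    (hcomm : ∀ x : M, mlieBracket (𝓡 4) K K' x = 0) :
    (∀ x : M, SelfdualEinstein.twistScalar o K K' K x = 0 ∧
      SelfdualEinstein.twistScalar o K K' K' x = 0) ∧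
    SelfdualEinstein.IsIntegrableOn (SelfdualEinstein.orthDistribution K K')
      {x : M | LinearIndependent ℝ ![K x, K' x]} := by
  have htw := SelfdualEinstein.twistScalar_eq_zero hsd hE hs hK hK' hcomm
  refine ⟨htw, hK.isIntegrableOn_orthDistribution hK' hcomm fun x hx u v hu hu' hv hv' => ?_⟩
  exact ⟨SelfdualEinstein.inner_apply_eq_zero_of_hodgeStar_eq_zero (o x) _ (hK.2 x) (htw x).1 hx
      hu hu' hv hv',
    SelfdualEinstein.inner_apply_eq_zero_of_hodgeStar_eq_zero (o x) _ (hK'.2 x) (htw x).2 hx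
      hu hu' hv hv'⟩

end
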